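/- **Theorem.** Write $\varrho(z)=\max(z,0)$, let $\|\cdot\|$ denote the Euclidean norm, and let $\pi_{\mathrm b}\colon\mathbb R\to\mathbb R$ be a probability density with at most polynomial decay, i.e. there is a polynomial $p_{\mathrm b}\colon\mathbb R\to(0,\infty)$ with $1\le p_{\mathrm b}(z)\,\pi_{\mathrm b}(z)$ for all $z\in\mathbb R$. Then there is an integer $k\ge 1$, depending only on $\pi_{\mathrm b}$, such that for all real $\nu>1$, $C>\frac{1}{2^{3/2}\pi}$ and $M>0$ there are constants $C_{\mathrm{app}},C_{\mathrm{wgt}}>0$, depending only on $\nu,\pi_{\mathrm b},C,M$, for which the following holds for all integers $d,N\ge 1$. Let $A_1,\dots,A_N$ be i.i.d. $\mathbb R^d$-valued random vectors with the multivariate $t$-distribution $t_\nu(0,\mathbf 1_d)$, i.e. with Lebesgue density $$\pi_{\mathrm w}(x)=\frac{\Gamma(\frac{\nu+d}{2})}{\Gamma(\frac{\nu}{2})\,\nu^{d/2}\,\pi^{d/2}}\Bigl(1+\nu^{-1}\|x\|^2\Bigr)^{-\frac{\nu+d}{2}},$$ let $B_1,\dots,B_N$ be i.i.d. real random variables with Lebesgue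 density $\pi_{\mathrm b}$, and let $A=(A_1,\dots,A_N)$ and $B=(B_1,\dots,B_N)$ be independent. Let $H\colon\mathbb R^d\to\mathbb R$ be of the form $H(x)=\mathbb E[\Phi(x+V)]$ with $\Phi\in L^1(\mathbb R^d)$ and an $\mathbb R^d$-valued random vector $V$ satisfying $|\mathbb E[e^{i\xi\cdot V}]|\le\exp(-C\|\xi\|^2)$ for all $\xi\in\mathbb R^d$. Then there is a $\sigma(A,B)$-measurable, $\mathbb R^N$-valued random vector $W=(W_1,\dots,W_N)$ such that the random neural network $H_W^{A,B}(x)=\sum_{i=1}^N W_i\,\varrho(A_i\cdot x+B_i)$ satisfies $$\mathbb E\Bigl[\sup_{x\in[-M,M]^d}\bigl|H_W^{A,B}(x)-H(x)\bigr|\Bigr]\le\frac{C_{\mathrm{app}}\,\|\Phi\|_{L^1(\mathbb R^d)}\,(\nu+d)^{k+3}}{\sqrt N}$$ and $$\|W_i\|_{L^\infty(\mathbb P)}\le\frac{C_{\mathrm{wgt}}\,\|\Phi\|_{L^1(\mathbb R^d)}\,(\nu+d)^{2k+\frac12}}{N}\qquad\text{for } i=1,\dots,N.$$ -/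

import Mathlib

open MeasureTheory ProbabilityTheory
open scoped ENNReal

noncomputable section

/-- The ReLU activation function. -/
def relu (z : ℝ) : ℝ := max z 0

/-- The single-hidden-layer ReLU network with hidden weights `a`, `b` and output weights `w`. -/
def reluNetwork {d N : ℕ} (a : Fin N → EuclideanSpace ℝ (Fin d)) (b w : Fin N → ℝ)
    (x : EuclideanSpace ℝ (Fin d)) : ℝ :=
  ∑ i, w i * relu (inner ℝ (a i) x + b i)

/-- The cube `[-M, M]^d`. -/
def cube (d : ℕ) (M : ℝ) : Set (EuclideanSpace ℝ (Fin d)) :=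
  {x | ∀ j, x j ∈ Set.Icc (-M) M}

/-- The Lebesgue density of the multivariate t-distribution `t_ν(0, 1_d)`. -/
def multivariateTPDF (d : ℕ) (ν : ℝ) (x : EuclideanSpace ℝ (Fin d)) : ℝ :=
  Real.Gamma ((ν + d) / 2) / (Real.Gamma (ν / 2) * ν ^ ((d : ℝ) / 2) * Real.pi ^ ((d : ℝ) / 2))
    * (1 + ν⁻¹ * ‖x‖ ^ 2) ^ (-(ν + d) / 2)

/-- The multivariate t-distribution `t_ν(0, 1_d)`. -/
def multivariateT (d : ℕ) (ν : ℝ) : Measure (EuclideanSpace ℝ (Fin d)) :=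
  volume.withDensity fun x => ENNReal.ofReal (multivariateTPDF d ν x)

/-- The density `πb` has at most polynomial decay: `1 ≤ p z * πb z` for all `z`, for some
polynomial `p` with values in `(0, ∞)`. -/
def AtMostPolynomialDecay (πb : ℝ → ℝ) : Prop :=
  ∃ p : Polynomial ℝ, (∀ z, 0 < p.eval z) ∧ ∀ z, 1 ≤ p.eval z * πb z

/-- The sigma-algebra `σ(A, B)` on `Ω` generated by all the hidden weights. -/
abbrev hiddenSigma {Ω : Type*} {d N : ℕ} (A : Fin N → Ω → EuclideanSpace ℝ (Fin d))
    (B : Fin N → Ω → ℝ) : MeasurableSpace Ω :=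
  MeasurableSpace.comap (fun ω => ((fun i => A i ω), (fun i => B i ω)))
    (inferInstance : MeasurableSpace ((Fin N → EuclideanSpace ℝ (Fin d)) × (Fin N → ℝ)))

end

/-! ### Suprema of centred empirical processes -/

/-! The target is an expectation over the hidden weights, and the network is its Monte Carlo
average. Since the characteristic function of `V` is dominated by a Gaussian, Fourier inversion
writes `H x` as an integral of `exp (i a·x)` against a weight of size at most `(2π)^(-d) exp
(-C‖a‖²) ‖Φ‖₁`. On the cube `|a·x| ≤ d M ‖a‖`, and on such an interval Taylor's formula turns the
exponential into an integral of shifted ReLUs (`integral_ridgeKernel_mul_relu`). Dividing by the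
sampling densities gives `w(a, b)` with `E[w(A, B) relu(A·x + B)] = H x`, and `W i = w(A i, B i) /
N`.

The point is that `|w| (1 + ‖a‖ + |b|)` is bounded by a multiple of `‖Φ‖₁` uniformly in `d`
(`exists_weight_bound`). An elementary Gamma function inequality bounds the ratio of the Gaussian to
the `t`-density by a constant times `(ν + d) q^d`, where `q < 1` by the threshold on `C`. The
geometric factor absorbs every power of `d`, including those produced by the polynomial controlling
`1 / πb`, so `k = 1` always suffices.

The uniform error comes from symmetrization and contraction: ReLU is 1-Lipschitz, so the process is
compared with a linear one, indexed by the vectors `(x, 1)` of norm at most `d M + 1`. Its supremum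
is controlled by a Hilbert space norm, which grows like `√N`, without covering numbers
(`integral_ciSup_inner_add_sum_centered_le`). -/

theorem ciSup_add_ciSup_sub_le {ι : Type*} [Nonempty ι] {F φ t : ι → ℝ}
    (h : ∀ i j, |φ i - φ j| ≤ |t i - t j|) (h1 : BddAbove (Set.range fun i => F i + t i))
    (h2 : BddAbove (Set.range fun i => F i - t i)) :
    (⨆ i, (F i + φ i)) + (⨆ i, (F i - φ i)) ≤ (⨆ i, (F i + t i)) + ⨆ i, (F i - t i) := by
  have key : ∀ i j, F i + φ i + (F j - φ j) ≤ (⨆ i, (F i + t i)) + ⨆ i, (F i - t i) := by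
    intro i j
    have a1 := le_ciSup h1 i
    have a2 := le_ciSup h2 i
    have a3 := le_ciSup h1 j
    have a4 := le_ciSup h2 j
    have b1 := (le_abs_self (φ i - φ j)).trans (h i j)
    -- The index with the larger value of `t` is used in the supremum with `+t`, the other in the
    -- one with `-t`.
    rcases abs_cases (t i - t j) with ⟨e, -⟩ | ⟨e, -⟩ <;> linarith
  have : ∀ j, (⨆ i, (F i + φ i)) ≤ (⨆ i, (F i + t i)) + (⨆ i, (F i - t i)) - (F j - φ j) :=
    fun j => ciSup_le fun i => by linarith [key i j]
  have h3 : (⨆ j, (F j - φ j)) ≤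
      (⨆ i, (F i + t i)) + (⨆ i, (F i - t i)) - ⨆ i, (F i + φ i) :=
    ciSup_le fun j => by linarith [this j]
  linarith

theorem bddAbove_range_of_abs_le {ι : Type*} {F : ι → ℝ} {D : ℝ} (h : ∀ i, |F i| ≤ D) :
    BddAbove (Set.range F) :=
  ⟨D, by rintro _ ⟨i, rfl⟩; exact (le_abs_self _).trans (h i)⟩

theorem abs_ciSup_le {ι : Type*} [Nonempty ι] {F : ι → ℝ} {D : ℝ} (h : ∀ i, |F i| ≤ D) :
    |⨆ i, F i| ≤ D := by
  obtain ⟨i⟩ := ‹Nonempty ι›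
  have : Nonempty ι := ⟨i⟩
  refine abs_le.2 ⟨?_, ciSup_le fun i => (le_abs_self _).trans (h i)⟩
  exact (abs_le.1 (h i)).1.trans (le_ciSup (bddAbove_range_of_abs_le h) i)

theorem integrable_ciSup {ι Z : Type*} [Nonempty ι] [Countable ι] [MeasurableSpace Z]
    {μ : Measure Z} [IsFiniteMeasure μ] {G : Z → ι → ℝ} {D : ℝ}
    (hG : ∀ i, Measurable fun z => G z i) (h : ∀ z i, |G z i| ≤ D) :
    Integrable (fun z => ⨆ i, G z i) μ :=
  Integrable.of_bound (Measurable.iSup hG).aestronglyMeasurable D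
    (Filter.Eventually.of_forall fun z => abs_ciSup_le (h z))

/-- Symmetrization and contraction for a single random summand. -/
theorem integral_ciSup_add_centered_le {ι Z : Type*} [Nonempty ι] [Countable ι]
    [MeasurableSpace Z] {μ : Measure Z} [IsProbabilityMeasure μ] {F : ι → ℝ} {Y t : Z → ι → ℝ}
    {A D T : ℝ} (hF : ∀ i, |F i| ≤ A)
    (hYm : ∀ i, Measurable fun z => Y z i) (hY : ∀ z i, |Y z i| ≤ D)
    (htm : ∀ i, Measurable fun z => t z i) (ht : ∀ z i, |t z i| ≤ T)
    (hlip : ∀ z i j, |2 * Y z i - 2 * Y z j| ≤ |t z i - t z j|) :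
    ∫ z, ⨆ i, (F i + (Y z i - ∫ z', Y z' i ∂μ)) ∂μ ≤
      ∫ z, ((⨆ i, (F i + t z i)) + (⨆ i, (F i - t z i))) / 2 ∂μ := by
  have hYint : ∀ i, Integrable (fun z => Y z i) μ := fun i =>
    Integrable.of_bound (hYm i).aestronglyMeasurable D (Filter.Eventually.of_forall fun z => hY z i)
  have bp : ∀ z i, |F i + 2 * Y z i| ≤ A + 2 * D := fun z i => by
    have := hF i; have := hY z i; rw [abs_le] at *; constructor <;> linarith
  have bm : ∀ z i, |F i - 2 * Y z i| ≤ A + 2 * D := fun z i => by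
    have := hF i; have := hY z i; rw [abs_le] at *; constructor <;> linarith
  have tp : ∀ z i, |F i + t z i| ≤ A + T := fun z i => by
    have := hF i; have := ht z i; rw [abs_le] at *; constructor <;> linarith
  have tm : ∀ z i, |F i - t z i| ≤ A + T := fun z i => by
    have := hF i; have := ht z i; rw [abs_le] at *; constructor <;> linarith
  have ip : Integrable (fun z => ⨆ i, (F i + 2 * Y z i)) μ :=
    integrable_ciSup (fun i => ((hYm i).const_mul 2).const_add _) bp
  have im : Integrable (fun z => ⨆ i, (F i - 2 * Y z i)) μ :=
    integrable_ciSup (fun i => ((hYm i).const_mul 2).const_sub _) bm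
  have jp : Integrable (fun z => ⨆ i, (F i + t z i)) μ :=
    integrable_ciSup (fun i => (htm i).const_add _) tp
  have jm : Integrable (fun z => ⨆ i, (F i - t z i)) μ :=
    integrable_ciSup (fun i => (htm i).const_sub _) tm
  have hm : ∀ i, |∫ z', Y z' i ∂μ| ≤ D := fun i => by
    have := norm_integral_le_of_norm_le_const (μ := μ) (f := fun z => Y z i)
      (Filter.Eventually.of_forall fun z => hY z i)
    simpa using this
  have il : Integrable (fun z => ⨆ i, (F i + (Y z i - ∫ z', Y z' i ∂μ))) μ := by
    refine integrable_ciSup (D := A + 2 * D) (fun i => ((hYm i).sub_const _).const_add _) ?_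
    intro z i
    have := hF i; have := hY z i; have := hm i
    rw [abs_le] at *; constructor <;> linarith
  -- `F + Y - EY` is the mean of `F + 2Y` and `F - 2EY`, and the supremum of the latter is at most
  -- `c` since a supremum of means is at most the mean of suprema. The two signs thus appear without
  -- an independent copy.
  set c := ∫ z, ⨆ i, (F i - 2 * Y z i) ∂μ with hc
  have hi : ∀ i, F i - 2 * ∫ z', Y z' i ∂μ ≤ c := by
    intro i
    have e : F i - 2 * ∫ z', Y z' i ∂μ = ∫ z', (F i - 2 * Y z' i) ∂μ := by
      rw [integral_sub (integrable_const _) ((hYint i).const_mul 2), integral_const_mul]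
      simp
    rw [e]
    exact integral_mono ((integrable_const _).sub ((hYint i).const_mul 2)) im
      fun z => le_ciSup (bddAbove_range_of_abs_le (bm z)) i
  have hz : ∀ z, (⨆ i, (F i + (Y z i - ∫ z', Y z' i ∂μ))) ≤
      ((⨆ i, (F i + 2 * Y z i)) + c) / 2 := by
    intro z
    refine ciSup_le fun i => ?_
    have := le_ciSup (bddAbove_range_of_abs_le (bp z)) i
    linarith [hi i]
  calc ∫ z, ⨆ i, (F i + (Y z i - ∫ z', Y z' i ∂μ)) ∂μ
      ≤ ∫ z, ((⨆ i, (F i + 2 * Y z i)) + c) / 2 ∂μ :=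
        integral_mono il ((ip.add (integrable_const _)).div_const 2) hz
    _ = ∫ z, ((⨆ i, (F i + 2 * Y z i)) + (⨆ i, (F i - 2 * Y z i))) / 2 ∂μ := by
        rw [integral_div, integral_div, integral_add ip (integrable_const _),
          integral_add ip im]
        simp [hc]
    _ ≤ _ := by
        refine integral_mono ((ip.add im).div_const 2) ((jp.add jm).div_const 2) fun z => ?_
        have := ciSup_add_ciSup_sub_le (F := F) (φ := fun i => 2 * Y z i) (t := t z) (hlip z)
          (bddAbove_range_of_abs_le (tp z)) (bddAbove_range_of_abs_le (tm z))
        simp only at this ⊢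
        linarith

/-- Concavity of the square root combined with the parallelogram law. This is the induction step for
the `√N` growth: a random sign in front of `v` adds only `K ^ 2` under the root. -/
theorem sqrt_norm_add_sq_add_sqrt_norm_sub_sq_le {E : Type*} [NormedAddCommGroup E]
    [InnerProductSpace ℝ E] (s v : E) {a K : ℝ} (ha : 0 ≤ a) (hv : ‖v‖ ≤ K) :
    (√(‖s + v‖ ^ 2 + a) + √(‖s - v‖ ^ 2 + a)) / 2 ≤ √(‖s‖ ^ 2 + (a + K ^ 2)) := by
  apply Real.le_sqrt_of_sq_le
  have h1 := Real.sq_sqrt (show 0 ≤ ‖s + v‖ ^ 2 + a by positivity)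
  have h2 := Real.sq_sqrt (show 0 ≤ ‖s - v‖ ^ 2 + a by positivity)
  have h3 := parallelogram_law_with_norm ℝ s v
  have h4 : ‖v‖ ^ 2 ≤ K ^ 2 := by gcongr
  nlinarith [sq_nonneg (√(‖s + v‖ ^ 2 + a) - √(‖s - v‖ ^ 2 + a))]

section EmpiricalSup

variable {ι Z E : Type*} [Nonempty ι] [Countable ι] [MeasurableSpace Z]
  [NormedAddCommGroup E] [InnerProductSpace ℝ E] {μ : Measure Z} [IsProbabilityMeasure μ]
  {Y : Z → ι → ℝ} {v : Z → E} {u : ι → E} {D K U : ℝ}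

/-- Samples are integrated out one at a time, each being replaced by `± v z`. The linear offset `s`
is what makes the induction close: the replaced sample is absorbed into it. -/
theorem integral_ciSup_inner_add_sum_centered_le
    (hYm : ∀ i, Measurable fun z => Y z i) (hY : ∀ z i, |Y z i| ≤ D)
    (hvm : ∀ i, Measurable fun z => inner ℝ (v z) (u i)) (hv : ∀ z, ‖v z‖ ≤ K)
    (hu : ∀ i, ‖u i‖ ≤ U)
    (hlip : ∀ z i j, |2 * Y z i - 2 * Y z j| ≤ |inner ℝ (v z) (u i) - inner ℝ (v z) (u j)|)
    (N : ℕ) (s : E) :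
    ∫ z : Fin N → Z, ⨆ i, (inner ℝ s (u i) + ∑ j, (Y (z j) i - ∫ z', Y z' i ∂μ))
      ∂(Measure.pi fun _ => μ) ≤ U * √(‖s‖ ^ 2 + N * K ^ 2) := by
  have hU : 0 ≤ U := by
    obtain ⟨i⟩ := ‹Nonempty ι›
    exact (norm_nonneg _).trans (hu i)
  have hsu : ∀ s i, |inner ℝ s (u i)| ≤ ‖s‖ * U := fun s i =>
    (abs_real_inner_le_norm _ _).trans (by gcongr; exact hu i)
  have hm : ∀ i, |∫ z', Y z' i ∂μ| ≤ D := fun i => by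
    have := norm_integral_le_of_norm_le_const (μ := μ) (f := fun z => Y z i)
      (Filter.Eventually.of_forall fun z => hY z i)
    simpa using this
  have hsum : ∀ (n : ℕ) (z : Fin n → Z) i,
      |∑ j, (Y (z j) i - ∫ z', Y z' i ∂μ)| ≤ n * (2 * D) := by
    intro n z i
    refine (Finset.abs_sum_le_sum_abs _ _).trans ?_
    refine (Finset.sum_le_card_nsmul _ _ (2 * D) fun j _ => ?_).trans (by simp)
    refine (abs_sub _ _).trans ?_
    linarith [hY (z j) i, hm i]
  have htot : ∀ (s : E) (n : ℕ) (z : Fin n → Z) i,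
      |inner ℝ s (u i) + ∑ j, (Y (z j) i - ∫ z', Y z' i ∂μ)| ≤ ‖s‖ * U + n * (2 * D) :=
    fun s n z i => (abs_add_le _ _).trans (add_le_add (hsu s i) (hsum n z i))
  have hmeas : ∀ (n : ℕ) i, Measurable fun z : Fin n → Z =>
      ∑ j, (Y (z j) i - ∫ z', Y z' i ∂μ) := fun n i =>
    Finset.measurable_sum _ fun j _ => ((hYm i).comp (measurable_pi_apply j)).sub_const _
  induction N generalizing s with
  | zero =>
    simp only [Finset.univ_eq_empty, Finset.sum_empty, add_zero, integral_const, Nat.cast_zero,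
      zero_mul, Real.sqrt_sq (norm_nonneg _)]
    simp only [probReal_univ, smul_eq_mul, one_mul]
    refine ciSup_le fun i => (le_abs_self _).trans ?_
    rw [mul_comm]; exact hsu s i
  | succ n ih =>
    have mp := measurePreserving_piFinSuccAbove (fun _ : Fin (n + 1) => μ) 0
    have hD : 0 ≤ D := by
      obtain ⟨i⟩ := ‹Nonempty ι›
      exact (abs_nonneg _).trans (hm i)
    set π' : Measure (Fin n → Z) := Measure.pi fun _ => μ with hπ'
    have hvK : ∀ z, ‖s + v z‖ ≤ ‖s‖ + K := fun z => (norm_add_le _ _).trans (by gcongr; exact hv z)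
    have hvK' : ∀ z, ‖s - v z‖ ≤ ‖s‖ + K := fun z => (norm_sub_le _ _).trans (by gcongr; exact hv z)
    have hK : 0 ≤ K := by
      obtain ⟨z⟩ := nonempty_of_isProbabilityMeasure μ
      exact (norm_nonneg _).trans (hv z)
    have e1 : ∫ z : Fin (n + 1) → Z, ⨆ i, (inner ℝ s (u i) +
          ∑ j, (Y (z j) i - ∫ z', Y z' i ∂μ)) ∂(Measure.pi fun _ => μ)
        = ∫ p : Z × (Fin n → Z), ⨆ i, (inner ℝ s (u i) +
          ∑ j, (Y (p.2 j) i - ∫ z', Y z' i ∂μ) + (Y p.1 i - ∫ z', Y z' i ∂μ)) ∂(μ.prod π') := by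
      rw [← mp.integral_comp (MeasurableEquiv.measurableEmbedding _)]
      refine integral_congr_ae (Filter.Eventually.of_forall fun z => ?_)
      simp only
      congr 1
      funext i
      rw [Fin.sum_univ_succ]
      simp only [MeasurableEquiv.piFinSuccAbove_apply, Fin.insertNthEquiv_zero,
        Fin.consEquiv_symm_apply, Fin.tail]
      ring
    have ib : Integrable (fun p : Z × (Fin n → Z) => ⨆ i, (inner ℝ s (u i) +
          ∑ j, (Y (p.2 j) i - ∫ z', Y z' i ∂μ) + (Y p.1 i - ∫ z', Y z' i ∂μ))) (μ.prod π') := by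
      refine integrable_ciSup (D := ‖s‖ * U + n * (2 * D) + 2 * D) (fun i => ?_) fun p i => ?_
      · exact (((hmeas n i).comp measurable_snd).const_add _).add
          (((hYm i).comp measurable_fst).sub_const _)
      · refine (abs_add_le _ _).trans (add_le_add (htot s n p.2 i) ?_)
        refine (abs_sub _ _).trans ?_
        linarith [hY p.1 i, hm i]
    have ibs : ∀ (σ : E → E) (hσ : ∀ z, ‖s + σ (v z)‖ ≤ ‖s‖ + K)
        (hσm : ∀ i, Measurable fun z => inner ℝ (s + σ (v z)) (u i)),
        Integrable (fun p : Z × (Fin n → Z) => ⨆ i, (inner ℝ (s + σ (v p.1)) (u i) +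
          ∑ j, (Y (p.2 j) i - ∫ z', Y z' i ∂μ))) (μ.prod π') := by
      intro σ hσ hσm
      refine integrable_ciSup (D := (‖s‖ + K) * U + n * (2 * D)) (fun i => ?_) fun p i => ?_
      · exact ((hσm i).comp measurable_fst).add ((hmeas n i).comp measurable_snd)
      · refine (htot _ n p.2 i).trans ?_
        gcongr
        exact hσ p.1
    have ibp := ibs id (by simpa using hvK)
      (fun i => by simpa [inner_add_left] using (hvm i).const_add _)
    have ibm := ibs (fun x => -x) (by simpa [sub_eq_add_neg] using hvK')
      (fun i => by simpa [inner_add_left, inner_neg_left] using (hvm i).neg.const_add _)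
    simp only [id, ← sub_eq_add_neg] at ibp ibm
    rw [e1, integral_prod_symm _ ib]
    have step : ∀ z : Fin n → Z, ∫ x, ⨆ i, (inner ℝ s (u i) +
          ∑ j, (Y (z j) i - ∫ z', Y z' i ∂μ) + (Y x i - ∫ z', Y z' i ∂μ)) ∂μ ≤
        ∫ x, ((⨆ i, (inner ℝ (s + v x) (u i) + ∑ j, (Y (z j) i - ∫ z', Y z' i ∂μ))) +
          (⨆ i, (inner ℝ (s - v x) (u i) + ∑ j, (Y (z j) i - ∫ z', Y z' i ∂μ)))) / 2 ∂μ := by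
      -- With the other samples frozen, everything except the first summand plays the role of `F`.
      intro z
      refine (integral_ciSup_add_centered_le (htot s n z) hYm hY hvm (T := K * U)
        (fun x i => (hsu _ _).trans (by gcongr; exact hv x)) hlip).trans_eq ?_
      refine integral_congr_ae (Filter.Eventually.of_forall fun x => ?_)
      simp only [inner_add_left, inner_sub_left]
      congr 3 <;> funext i <;> ring
    have ic : Integrable (fun p : Z × (Fin n → Z) =>
        ((⨆ i, (inner ℝ (s + v p.1) (u i) + ∑ j, (Y (p.2 j) i - ∫ z', Y z' i ∂μ))) +
          (⨆ i, (inner ℝ (s - v p.1) (u i) + ∑ j, (Y (p.2 j) i - ∫ z', Y z' i ∂μ)))) / 2)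
        (μ.prod π') := (ibp.add ibm).div_const 2
    refine (integral_mono ib.integral_prod_right ic.integral_prod_right step).trans ?_
    rw [← integral_prod_symm _ ic, integral_prod _ ic]
    have hz : ∀ x, ∫ z, ((⨆ i, (inner ℝ (s + v x) (u i) +
          ∑ j, (Y (z j) i - ∫ z', Y z' i ∂μ))) +
          (⨆ i, (inner ℝ (s - v x) (u i) + ∑ j, (Y (z j) i - ∫ z', Y z' i ∂μ)))) / 2 ∂π' ≤
        U * √(‖s‖ ^ 2 + ((n + 1 : ℕ) : ℝ) * K ^ 2) := by
      intro x
      have i1 : ∀ s : E, Integrable (fun z : Fin n → Z =>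
          ⨆ i, (inner ℝ s (u i) + ∑ j, (Y (z j) i - ∫ z', Y z' i ∂μ))) π' := fun s =>
        integrable_ciSup (fun i => (hmeas n i).const_add _) (htot s n)
      rw [integral_div, integral_add (i1 _) (i1 _)]
      have q := sqrt_norm_add_sq_add_sqrt_norm_sub_sq_le s (v x) (a := n * K ^ 2)
        (by positivity) (hv x)
      have e : ‖s‖ ^ 2 + ((n + 1 : ℕ) : ℝ) * K ^ 2 = ‖s‖ ^ 2 + (n * K ^ 2 + K ^ 2) := by
        push_cast; ring
      rw [e]
      have q2 := mul_le_mul_of_nonneg_left q hU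
      linarith [ih (s + v x), ih (s - v x)]
    refine (integral_mono ic.integral_prod_left (integrable_const _) hz).trans_eq ?_
    simp

/-- Expected uniform deviation of an empirical process whose increments are dominated by those of a
bounded linear process. -/
theorem integral_ciSup_abs_sum_centered_le
    (hYm : ∀ i, Measurable fun z => Y z i) (hY : ∀ z i, |Y z i| ≤ D)
    (hvm : ∀ i, Measurable fun z => inner ℝ (v z) (u i)) (hv : ∀ z, ‖v z‖ ≤ K)
    (hu : ∀ i, ‖u i‖ ≤ U)
    (hlip : ∀ z i j, |Y z i - Y z j| ≤ |inner ℝ (v z) (u i) - inner ℝ (v z) (u j)|)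
    (hle : ∀ z i, |Y z i| ≤ |inner ℝ (v z) (u i)|) (N : ℕ) :
    ∫ z : Fin N → Z, ⨆ i, |∑ j, (Y (z j) i - ∫ z', Y z' i ∂μ)|
      ∂(Measure.pi fun _ => μ) ≤ 4 * U * K * √N := by
  have hU : 0 ≤ U := by
    obtain ⟨i⟩ := ‹Nonempty ι›
    exact (norm_nonneg _).trans (hu i)
  have hK : 0 ≤ K := by
    obtain ⟨z⟩ := nonempty_of_isProbabilityMeasure μ
    exact (norm_nonneg _).trans (hv z)
  have hD : 0 ≤ D := by
    obtain ⟨i⟩ := ‹Nonempty ι›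
    obtain ⟨z⟩ := nonempty_of_isProbabilityMeasure μ
    exact (abs_nonneg _).trans (hY z i)
  -- An extra index at which the process vanishes makes the suprema of `S` and `-S` nonnegative, so
  -- the supremum of `|S|` is at most their sum. Comparing increments with this index is where `hle`
  -- enters.
  let u' : Option ι → E := fun o => o.elim 0 u
  let Y' : ℝ → Z → Option ι → ℝ := fun σ z o => o.elim 0 fun i => σ * Y z i
  have hm : ∀ i, |∫ z', Y z' i ∂μ| ≤ D := fun i => by
    have := norm_integral_le_of_norm_le_const (μ := μ) (f := fun z => Y z i)
      (Filter.Eventually.of_forall fun z => hY z i)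
    simpa using this
  have hsum : ∀ (z : Fin N → Z) i, |∑ j, (Y (z j) i - ∫ z', Y z' i ∂μ)| ≤ N * (2 * D) := by
    intro z i
    refine (Finset.abs_sum_le_sum_abs _ _).trans ?_
    refine (Finset.sum_le_card_nsmul _ _ (2 * D) fun j _ => ?_).trans (by simp)
    refine (abs_sub _ _).trans ?_
    linarith [hY (z j) i, hm i]
  let S : ℝ → (Fin N → Z) → Option ι → ℝ := fun σ z o => ∑ j, (Y' σ (z j) o - ∫ z', Y' σ z' o ∂μ)
  have hSsome : ∀ σ z i, S σ z (some i) = σ * ∑ j, (Y (z j) i - ∫ z', Y z' i ∂μ) := by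
    intro σ z i
    simp only [S, Y', Option.elim_some, integral_const_mul, Finset.mul_sum, mul_sub]
  have hSnone : ∀ σ z, S σ z none = 0 := by
    intro σ z
    simp [S, Y']
  have hSb : ∀ σ, |σ| = 1 → ∀ z o, |S σ z o| ≤ N * (2 * D) := by
    rintro σ hσ z (_ | i)
    · rw [hSnone, abs_zero]; positivity
    · rw [hSsome, abs_mul, hσ, one_mul]; exact hsum z i
  have hY'm : ∀ σ o, Measurable fun z => Y' σ z o := by
    rintro σ (_ | i)
    · exact measurable_const
    · exact (hYm i).const_mul σ
  have hSm : ∀ σ o, Measurable fun z => S σ z o := fun σ o =>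
    Finset.measurable_sum _ fun j _ => ((hY'm σ o).comp (measurable_pi_apply j)).sub_const _
  have hSi : ∀ σ, |σ| = 1 → Integrable (fun z => ⨆ o, S σ z o) (Measure.pi fun _ => μ) :=
    fun σ hσ => integrable_ciSup (hSm σ) (hSb σ hσ)
  have main : ∀ σ, |σ| = 1 → ∫ z, ⨆ o, S σ z o ∂(Measure.pi fun _ => μ) ≤ 2 * U * K * √N := by
    intro σ hσ
    -- Doubling `v` pays for the factor 2 of symmetrization.
    have := integral_ciSup_inner_add_sum_centered_le (μ := μ) (Y := Y' σ)
      (v := fun z => (2 : ℝ) • v z) (u := u') (D := D) (K := 2 * K) (U := U) (hY'm σ)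
      ?_ ?_ ?_ ?_ ?_ N 0
    · simp only [inner_zero_left, zero_add, norm_zero] at this
      refine this.trans_eq ?_
      rw [show (0 : ℝ) ^ 2 + N * (2 * K) ^ 2 = N * (2 * K) ^ 2 by ring,
        Real.sqrt_mul (by positivity), Real.sqrt_sq (by positivity)]
      ring
    · rintro z (_ | i)
      · simpa [Y'] using hD
      · simpa [Y', abs_mul, hσ] using hY z i
    · rintro (_ | i)
      · simp [u']
      · simpa [u', inner_smul_left] using (hvm i).const_mul 2
    · intro z
      rw [norm_smul]; simpa using hv z
    · rintro (_ | i)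
      · simpa [u'] using hU
      · simpa [u'] using hu i
    · intro z i j
      rw [← mul_sub, inner_smul_left, inner_smul_left, ← mul_sub, abs_mul, abs_mul]
      simp only [conj_trivial]
      refine mul_le_mul_of_nonneg_left ?_ (abs_nonneg _)
      rcases i with _ | i <;> rcases j with _ | j
      · simp [Y', u']
      · simpa [Y', u', abs_mul, hσ] using hle z j
      · simpa [Y', u', abs_mul, hσ] using hle z i
      · simp only [Y', u', Option.elim_some]
        rw [← mul_sub, abs_mul, hσ, one_mul]
        exact hlip z i j
  have hpt : ∀ z, (⨆ i, |∑ j, (Y (z j) i - ∫ z', Y z' i ∂μ)|) ≤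
      (⨆ o, S 1 z o) + ⨆ o, S (-1) z o := by
    intro z
    refine ciSup_le fun i => ?_
    have b1 := bddAbove_range_of_abs_le (hSb 1 (by simp) z)
    have b2 := bddAbove_range_of_abs_le (hSb (-1) (by simp) z)
    have a1 := le_ciSup b1 (some i)
    have a2 := le_ciSup b2 (some i)
    have a3 := le_ciSup b1 none
    have a4 := le_ciSup b2 none
    rw [hSsome] at a1 a2
    rw [hSnone] at a3 a4
    refine abs_le.2 ⟨?_, ?_⟩ <;> linarith
  have hint : Integrable (fun z : Fin N → Z => ⨆ i, |∑ j, (Y (z j) i - ∫ z', Y z' i ∂μ)|)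
      (Measure.pi fun _ => μ) := by
    refine integrable_ciSup (D := N * (2 * D)) (fun i => ?_) fun z i => ?_
    · exact (Finset.measurable_sum _ fun j _ =>
        ((hYm i).comp (measurable_pi_apply j)).sub_const _).norm
    · rw [abs_abs]; exact hsum z i
  refine (integral_mono hint ((hSi 1 (by simp)).add (hSi (-1) (by simp))) hpt).trans ?_
  simp only [Pi.add_apply]
  rw [integral_add (hSi 1 (by simp)) (hSi (-1) (by simp))]
  linarith [main 1 (by simp), main (-1) (by simp)]

end EmpiricalSup

/-! ### Ridge representation of a complex exponential -/

open Complex in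
/-- The weight expressing `z ↦ Re (c * exp (i z))` on `[-R, R]` as an integral of shifted ReLUs. -/
noncomputable def ridgeKernel (c : ℂ) (R b : ℝ) : ℝ :=
  if |b| ≤ R then -(c * exp (-(b * I))).re
  else if R < b ∧ b ≤ R + 1 then
    (c * exp (-(R * I)) * ((4 * I - 6) + (12 - 6 * I) * ((b - R : ℝ) : ℂ))).re
  else 0

theorem relu_of_nonneg {z : ℝ} (h : 0 ≤ z) : relu z = z := max_eq_left h

theorem relu_of_nonpos {z : ℝ} (h : z ≤ 0) : relu z = 0 := max_eq_right h

theorem continuous_relu : Continuous relu := continuous_id.max continuous_const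

theorem abs_relu_sub_relu_le (x y : ℝ) : |relu x - relu y| ≤ |x - y| := abs_max_sub_max_le_abs _ _ _

theorem abs_relu_le (x : ℝ) : |relu x| ≤ |x| := by
  simpa [relu] using abs_relu_sub_relu_le x 0

theorem norm_exp_neg_real_mul_I (x : ℝ) : ‖Complex.exp (-(x * Complex.I))‖ = 1 := by
  have := Complex.norm_exp_ofReal_mul_I (-x)
  simpa using this

theorem abs_ridgeKernel_le (c : ℂ) (R b : ℝ) : |ridgeKernel c R b| ≤ 28 * ‖c‖ := by
  have hc := norm_nonneg c
  unfold ridgeKernel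
  split_ifs with h1 h2
  · rw [abs_neg]
    refine (Complex.abs_re_le_norm _).trans ?_
    rw [norm_mul, norm_exp_neg_real_mul_I]
    linarith
  · refine (Complex.abs_re_le_norm _).trans ?_
    rw [norm_mul, norm_mul, norm_exp_neg_real_mul_I, mul_one, mul_comm]
    refine mul_le_mul_of_nonneg_right ?_ hc
    refine (norm_add_le _ _).trans ?_
    rw [norm_mul]
    have e1 : ‖(4 * Complex.I - 6 : ℂ)‖ ≤ 10 := by
      refine (norm_sub_le _ _).trans ?_
      rw [norm_mul]; norm_num
    have e2 : ‖(12 - 6 * Complex.I : ℂ)‖ ≤ 18 := by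
      refine (norm_sub_le _ _).trans ?_
      rw [norm_mul]; norm_num
    have e3 : ‖((b - R : ℝ) : ℂ)‖ ≤ 1 := by
      rw [Complex.norm_real, Real.norm_eq_abs, abs_le]
      constructor <;> linarith [h2.1, h2.2]
    nlinarith [norm_nonneg (12 - 6 * Complex.I : ℂ), norm_nonneg ((b - R : ℝ) : ℂ)]
  · simp only [abs_zero]; positivity

theorem ridgeKernel_eq_zero {c : ℂ} {R b : ℝ} (hR : 0 ≤ R) (h : R + 1 < |b|) :
    ridgeKernel c R b = 0 := by
  unfold ridgeKernel
  rw [if_neg (by linarith), if_neg]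
  rintro ⟨h1, h2⟩
  rw [abs_of_pos (by linarith)] at h
  linarith

theorem measurable_ridgeKernel {α : Type*} [MeasurableSpace α] {c : α → ℂ} {R b : α → ℝ}
    (hc : Measurable c) (hR : Measurable R) (hb : Measurable b) :
    Measurable fun x => ridgeKernel (c x) (R x) (b x) := by
  unfold ridgeKernel
  refine Measurable.ite (measurableSet_le hb.norm hR) ?_
    (Measurable.ite ((measurableSet_lt hR hb).inter (measurableSet_le hb (hR.add_const 1))) ?_
      measurable_const)
  · fun_prop
  · fun_prop

open Complex in
-- Taylor's formula at `-R` for `f z = Re (c exp (i z))`. On `[-R, R]` the kernel is `f'' (-b)`,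
-- which yields the integral remainder. For `b > R` the ReLU is affine in `z`, and the piece on `(R,
-- R + 1]` reproduces `f (-R) + f' (-R) (z + R)`.
theorem integral_ridgeKernel_mul_relu (c : ℂ) {R z : ℝ} (hz : |z| ≤ R) :
    ∫ b, ridgeKernel c R b * relu (z + b) = (c * exp (z * I)).re := by
  have hz1 := (abs_le.1 hz).1
  have hz2 := (abs_le.1 hz).2
  have hR : 0 ≤ R := (abs_nonneg z).trans hz
  have i1 : ∫ b in (-z)..R, -(c * exp (-(b * I))).re * (z + b) =
      (c * exp (z * I)).re - (c * exp (-(R * I)) * (1 + I * (z + R))).re := by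
    have hd : ∀ b ∈ Set.uIcc (-z) R, HasDerivAt
        (fun b : ℝ => -(c * exp (-(b * I)) * (1 + I * (z + b))).re)
        (-(c * exp (-(b * I))).re * (z + b)) b := by
      intro b _
      have h1 : HasDerivAt (fun b : ℝ => (c * exp (-(b * I)) * (1 + I * (z + b))))
          (c * exp (-(b * I)) * (z + b)) b := by
        have h0 : HasDerivAt (fun b : ℝ => (b : ℂ)) 1 b := Complex.ofRealCLM.hasDerivAt
        refine ((((h0.mul_const I).neg.cexp).const_mul c).mul
          (((h0.const_add (z : ℂ)).const_mul I).const_add 1)).congr_deriv ?_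
        linear_combination (-(c * exp (-(b * I)) * (z + b))) * I_mul_I
      have h2 := (Complex.reCLM.hasFDerivAt.comp_hasDerivAt b h1).neg
      refine h2.congr_deriv ?_
      simp only [Complex.reCLM_apply]
      rw [← Complex.ofReal_add, Complex.re_mul_ofReal]
      ring
    rw [intervalIntegral.integral_eq_sub_of_hasDerivAt hd]
    · simp only [ofReal_neg, neg_mul, neg_neg, add_neg_cancel, mul_zero, add_zero, mul_one]
      ring
    · apply Continuous.intervalIntegrable
      fun_prop
  -- The coefficients of `α + β t`, `t = b - R`, solve `∫ (α + β t) = i` and `∫ (α + β t) t = 1`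
  -- over `[0, 1]`, giving `α = 4i - 6` and `β = 12 - 6i`.
  have i2 : ∫ b in R..(R + 1), (c * exp (-(R * I)) *
      ((4 * I - 6) + (12 - 6 * I) * ((b - R : ℝ) : ℂ))).re * (z + b) =
      (c * exp (-(R * I)) * (1 + I * (z + R))).re := by
    set ω := c * exp (-(R * I)) with hω
    have e : ∀ b : ℝ, (ω * ((4 * I - 6) + (12 - 6 * I) * ((b - R : ℝ) : ℂ))).re =
        (-4 * ω.im - 6 * ω.re) + (12 * ω.re + 6 * ω.im) * (b - R) := by
      intro b
      simp [Complex.mul_re, Complex.mul_im]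
      ring
    simp only [e]
    have hd : ∀ b ∈ Set.uIcc R (R + 1), HasDerivAt
        (fun b : ℝ => (-4 * ω.im - 6 * ω.re) * (z + R) * (b - R) +
          ((-4 * ω.im - 6 * ω.re) / 2 + (12 * ω.re + 6 * ω.im) * (z + R) / 2) * (b - R) ^ 2 +
          (12 * ω.re + 6 * ω.im) / 3 * (b - R) ^ 3)
        (((-4 * ω.im - 6 * ω.re) + (12 * ω.re + 6 * ω.im) * (b - R)) * (z + b)) b := by
      intro b _
      have h0 : HasDerivAt (fun b : ℝ => b - R) 1 b := (hasDerivAt_id b).sub_const R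
      refine (((h0.const_mul ((-4 * ω.im - 6 * ω.re) * (z + R))).add
        ((h0.pow 2).const_mul ((-4 * ω.im - 6 * ω.re) / 2 +
          (12 * ω.re + 6 * ω.im) * (z + R) / 2))).add
        ((h0.pow 3).const_mul ((12 * ω.re + 6 * ω.im) / 3))).congr_deriv ?_
      simp only [Nat.cast_ofNat]
      ring
    rw [intervalIntegral.integral_eq_sub_of_hasDerivAt hd]
    · simp [Complex.mul_re, Complex.mul_im]
      ring
    · apply Continuous.intervalIntegrable
      fun_prop
  set g1 : ℝ → ℝ := fun b => -(c * exp (-(b * I))).re * (z + b) with hg1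
  set g2 : ℝ → ℝ := fun b => (c * exp (-(R * I)) *
      ((4 * I - 6) + (12 - 6 * I) * ((b - R : ℝ) : ℂ))).re * (z + b) with hg2
  have c1 : Continuous g1 := by fun_prop
  have c2 : Continuous g2 := by fun_prop
  have hsplit : (fun b => ridgeKernel c R b * relu (z + b)) =
      fun b => (Set.Ioc (-z) R).indicator g1 b + (Set.Ioc R (R + 1)).indicator g2 b := by
    funext b
    unfold ridgeKernel
    by_cases hb1 : b ≤ -z
    · rw [relu_of_nonpos (by linarith), mul_zero, Set.indicator_of_notMem, Set.indicator_of_notMem,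
        add_zero]
      · rintro ⟨h1, -⟩; linarith
      · rintro ⟨h1, -⟩; linarith
    push Not at hb1
    rw [relu_of_nonneg (by linarith)]
    by_cases hb2 : b ≤ R
    · rw [if_pos (abs_le.2 ⟨by linarith, hb2⟩), Set.indicator_of_mem (Set.mem_Ioc.2 ⟨hb1, hb2⟩),
        Set.indicator_of_notMem (fun h => absurd h.1 (not_lt.2 hb2)), add_zero]
    · have h3 : ¬ |b| ≤ R := fun h => hb2 ((le_abs_self b).trans h)
      rw [if_neg h3, Set.indicator_of_notMem (fun h => hb2 h.2), zero_add]
      push Not at hb2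
      by_cases hb3 : b ≤ R + 1
      · rw [if_pos ⟨hb2, hb3⟩, Set.indicator_of_mem (Set.mem_Ioc.2 ⟨hb2, hb3⟩)]
      · rw [if_neg (fun h => hb3 h.2), zero_mul, Set.indicator_of_notMem (fun h => hb3 h.2)]
  rw [hsplit, integral_add, integral_indicator measurableSet_Ioc,
    integral_indicator measurableSet_Ioc, ← intervalIntegral.integral_of_le (by linarith),
    ← intervalIntegral.integral_of_le (by linarith), i1, i2]
  · ring
  · exact (c1.integrableOn_Ioc).integrable_indicator measurableSet_Ioc
  · exact (c2.integrableOn_Ioc).integrable_indicator measurableSet_Ioc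

/-! ### Fourier representation of convolutions with rapidly decaying characteristic function -/

section Fourier

open FourierTransform Real
open scoped SchwartzMap ContDiff RealInnerProductSpace

variable {V : Type*} [NormedAddCommGroup V] [InnerProductSpace ℝ V]

theorem continuous_innerₗ_apply : Continuous fun p : V × V => innerₗ V p.1 p.2 := continuous_inner

theorem continuous_neg_innerₗ_apply : Continuous fun p : V × V => (-innerₗ V) p.1 p.2 :=
  (continuous_inner (𝕜 := ℝ) (E := V)).neg

theorem flip_neg_innerₗ : (-innerₗ V).flip = -innerₗ V := by
  ext x y; simp [real_inner_comm]

variable [MeasurableSpace V]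

theorem fourierIntegral_one_eq_charFun (ρ : Measure V) (ξ : V) :
    VectorFourier.fourierIntegral 𝐞 ρ (innerₗ V) (fun _ => (1 : ℂ)) ξ =
      charFun ρ (-(2 * π) • ξ) := by
  rw [vector_fourierIntegral_eq_integral_exp_smul, charFun_apply]
  congr 1
  funext x
  simp only [innerₗ_apply_apply, smul_eq_mul, mul_one, inner_smul_right]
  congr 2
  push_cast
  ring

variable [FiniteDimensional ℝ V] [BorelSpace V]

/-- The Fourier transform is moved across the pairing twice: first from `ρ` to `𝓕⁻ h`, where
inversion recovers `h`, then from `h` to the integrable characteristic function. -/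
theorem integral_schwartz_eq_integral_mul_fourierInv (ρ : Measure V) [IsFiniteMeasure ρ]
    (hρ : Integrable fun ξ => charFun ρ (-(2 * π) • ξ)) (h : 𝓢(V, ℂ)) :
    ∫ x, h x ∂ρ = ∫ x, h x * 𝓕⁻ (fun ξ => charFun ρ (-(2 * π) • ξ)) x := by
  have e1 := VectorFourier.integral_fourierIntegral_smul_eq_flip (μ := ρ) (ν := volume)
    (L := innerₗ V) (f := fun _ => (1 : ℂ)) (g := 𝓕⁻ (h : V → ℂ)) continuous_fourierChar
    continuous_innerₗ_apply
    (integrable_const _) (by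
      rw [← SchwartzMap.fourierInv_coe]; exact SchwartzMap.integrable _)
  have e2 := VectorFourier.integral_fourierIntegral_smul_eq_flip (μ := volume) (ν := volume)
    (L := -innerₗ V) (f := fun ξ => charFun ρ (-(2 * π) • ξ)) (g := (h : V → ℂ))
    continuous_fourierChar continuous_neg_innerₗ_apply hρ h.integrable
  have fl : (innerₗ V).flip = innerₗ V := by
    ext x y; simp
  rw [fl] at e1
  rw [flip_neg_innerₗ] at e2
  simp only [one_smul, fourierIntegral_one_eq_charFun] at e1
  have e3 : ∀ x, VectorFourier.fourierIntegral 𝐞 volume (innerₗ V) (𝓕⁻ (h : V → ℂ)) x = h x := by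
    intro x
    have h1 : 𝓕 (𝓕⁻ h) = h := FourierTransform.fourier_fourierInv_eq h
    have h2 : (𝓕 (𝓕⁻ h) : 𝓢(V, ℂ)) x = h x := by rw [h1]
    rw [SchwartzMap.fourier_coe, SchwartzMap.fourierInv_coe] at h2
    exact h2
  simp only [e3] at e1
  rw [← e1]
  have e4 : ∫ ξ, charFun ρ (-(2 * π) • ξ) • 𝓕⁻ (h : V → ℂ) ξ =
    ∫ ξ, 𝓕⁻ (fun ξ => charFun ρ (-(2 * π) • ξ)) ξ • h ξ := e2.symm
  rw [e4]
  simp only [smul_eq_mul, mul_comm]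

theorem continuous_fourierInv_of_integrable {g : V → ℂ} (hg : Integrable g) : Continuous (𝓕⁻ g) := by
  exact VectorFourier.fourierIntegral_continuous continuous_fourierChar continuous_neg_innerₗ_apply hg

/-- A finite measure with integrable characteristic function has the inverse Fourier transform of
that function as its density. -/
theorem integral_eq_integral_mul_fourierInv_charFun (ρ : Measure V) [IsFiniteMeasure ρ]
    (hρ : Integrable fun ξ => charFun ρ (-(2 * π) • ξ)) (h : V → ℂ) :
    ∫ x, h x ∂ρ = ∫ x, 𝓕⁻ (fun ξ => charFun ρ (-(2 * π) • ξ)) x * h x := by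
  set f := 𝓕⁻ (fun ξ => charFun ρ (-(2 * π) • ξ)) with hf
  have hfc : Continuous f := continuous_fourierInv_of_integrable hρ
  -- Absolute continuity of `ρ` is not yet known, so both sides are expressed by densities with
  -- respect to a common dominating measure. Testing against smooth compactly supported functions
  -- identifies these densities, and the identity then holds for every `h`, integrable or not.
  set μ : Measure V := ρ + volume with hμ
  have a1 : ρ ≪ μ := Measure.absolutelyContinuous_of_le (Measure.le_add_right le_rfl)
  have a2 : (volume : Measure V) ≪ μ :=
    Measure.absolutelyContinuous_of_le (Measure.le_add_left le_rfl)
  have l1 : LocallyIntegrable (fun x => ((ρ.rnDeriv μ x).toReal : ℂ)) μ :=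
    (Measure.integrable_toReal_rnDeriv.ofReal).locallyIntegrable
  have l2 : LocallyIntegrable (fun x => ((volume : Measure V).rnDeriv μ x).toReal • f x) μ := by
    rw [locallyIntegrable_iff]
    intro k hk
    rw [← integrable_indicator_iff hk.measurableSet]
    have : (k.indicator fun x => ((volume : Measure V).rnDeriv μ x).toReal • f x) =
        fun x => ((volume : Measure V).rnDeriv μ x).toReal • k.indicator f x := by
      funext x
      by_cases hx : x ∈ k <;> simp [hx]
    rw [this, integrable_rnDeriv_smul_iff a2, integrable_indicator_iff hk.measurableSet]
    exact hfc.continuousOn.integrableOn_compact hk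
  have key := ae_eq_of_integral_contDiff_smul_eq l1 l2 (by
    intro g gs gc
    have gc' : HasCompactSupport fun x => (g x : ℂ) :=
      gc.comp_left (g := fun x : ℝ => (x : ℂ)) (by simp)
    have gs' : ContDiff ℝ ∞ fun x => (g x : ℂ) := Complex.ofRealCLM.contDiff.comp gs
    have := integral_schwartz_eq_integral_mul_fourierInv ρ hρ (gc'.toSchwartzMap gs')
    rw [← integral_rnDeriv_smul a1, ← integral_rnDeriv_smul a2] at this
    refine Eq.trans ?_ (this.trans ?_)
    · refine integral_congr_ae (Filter.Eventually.of_forall fun x => ?_)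
      change g x • ((ρ.rnDeriv μ x).toReal : ℂ) = (ρ.rnDeriv μ x).toReal • (g x : ℂ)
      simp only [Complex.real_smul, mul_comm]
    · refine integral_congr_ae (Filter.Eventually.of_forall fun x => ?_)
      change ((volume : Measure V).rnDeriv μ x).toReal • ((g x : ℂ) * f x) =
        g x • ((volume : Measure V).rnDeriv μ x).toReal • f x
      simp only [Complex.real_smul]
      ring)
  rw [← integral_rnDeriv_smul a1, ← integral_rnDeriv_smul a2]
  refine integral_congr_ae ?_
  filter_upwards [key] with x hx
  rw [← Complex.coe_smul, smul_eq_mul, hx]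
  simp only [Complex.real_smul]
  ring

/-- The Fourier weight of the convolution of `Φ` with the reflection of `ρ`. -/
noncomputable def fourierWeight (ρ : Measure V) (Φ : V → ℝ) (a : V) : ℂ :=
  (((2 * π) ^ Module.finrank ℝ V)⁻¹ : ℝ) *
    (charFun ρ a * 𝓕 (fun y => (Φ y : ℂ)) ((2 * π)⁻¹ • a))

theorem norm_fourierWeight_le {ρ : Measure V} {Φ : V → ℝ} {C : ℝ}
    (hρ : ∀ ξ, ‖charFun ρ ξ‖ ≤ exp (-C * ‖ξ‖ ^ 2)) (a : V) :
    ‖fourierWeight ρ Φ a‖ ≤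
      ((2 * π) ^ Module.finrank ℝ V)⁻¹ * (exp (-C * ‖a‖ ^ 2) * ∫ x, |Φ x|) := by
  unfold fourierWeight
  rw [norm_mul, norm_mul, Complex.norm_real, Real.norm_of_nonneg (by positivity)]
  gcongr
  · exact hρ a
  · refine (VectorFourier.norm_fourierIntegral_le_integral_norm _ _ _ _ _).trans_eq ?_
    simp

theorem measurable_fourierWeight {ρ : Measure V} [IsFiniteMeasure ρ] {Φ : V → ℝ}
    (hΦ : Integrable Φ) : Measurable (fourierWeight ρ Φ) := by
  have : Continuous (𝓕 (fun y => (Φ y : ℂ))) :=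
    VectorFourier.fourierIntegral_continuous continuous_fourierChar continuous_innerₗ_apply hΦ.ofReal
  unfold fourierWeight
  exact (measurable_charFun.mul (this.measurable.comp (measurable_const_smul _))).const_mul _

theorem integrable_exp_neg_mul_sq_norm {C : ℝ} (hC : 0 < C) :
    Integrable fun a : V => exp (-C * ‖a‖ ^ 2) := by
  have := GaussianFourier.integrable_cexp_neg_mul_sq_norm_add (V := V) (b := (C : ℂ))
    (by simpa using hC) 0 0
  refine this.norm.congr (Filter.Eventually.of_forall fun a => ?_)
  simp [Complex.norm_exp, ← Complex.ofReal_pow, Complex.mul_re]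

theorem integrable_fourierWeight_mul_exp {ρ : Measure V} [IsFiniteMeasure ρ] {Φ : V → ℝ}
    (hΦ : Integrable Φ) {C : ℝ} (hC : 0 < C)
    (hρ : ∀ ξ, ‖charFun ρ ξ‖ ≤ exp (-C * ‖ξ‖ ^ 2)) (x : V) :
    Integrable fun a => fourierWeight ρ Φ a * Complex.exp (⟪a, x⟫ * Complex.I) := by
  refine Integrable.mono' (((integrable_exp_neg_mul_sq_norm hC).mul_const
    (∫ x, |Φ x|)).const_mul ((2 * π) ^ Module.finrank ℝ V)⁻¹) ?_
    (Filter.Eventually.of_forall fun a => ?_)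
  · refine ((measurable_fourierWeight hΦ).mul ?_).aestronglyMeasurable
    exact (by fun_prop : Continuous fun a => Complex.exp (⟪a, x⟫ * Complex.I)).measurable
  · rw [norm_mul, Complex.norm_exp_ofReal_mul_I, mul_one]
    exact norm_fourierWeight_le hρ a

theorem integrable_charFun_neg_two_pi_smul {ρ : Measure V} [IsFiniteMeasure ρ] {C : ℝ} (hC : 0 < C)
    (hρ : ∀ ξ, ‖charFun ρ ξ‖ ≤ exp (-C * ‖ξ‖ ^ 2)) :
    Integrable fun ξ => charFun ρ (-(2 * π) • ξ) := by
  have hφ0 : Integrable fun ξ => charFun ρ ξ :=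
    (integrable_exp_neg_mul_sq_norm hC).mono' measurable_charFun.aestronglyMeasurable
      (Filter.Eventually.of_forall hρ)
  exact hφ0.comp_smul (by simp [pi_ne_zero])

/-- Needed because `Φ` is only a.e. strongly measurable for Lebesgue measure, while it is evaluated
along `V`. -/
theorem absolutelyContinuous_of_norm_charFun_le {ρ : Measure V} [IsFiniteMeasure ρ] {C : ℝ}
    (hC : 0 < C) (hρ : ∀ ξ, ‖charFun ρ ξ‖ ≤ exp (-C * ‖ξ‖ ^ 2)) : ρ ≪ volume := by
  refine Measure.AbsolutelyContinuous.mk fun S hS h0 => ?_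
  have h := integral_eq_integral_mul_fourierInv_charFun ρ
    (integrable_charFun_neg_two_pi_smul hC hρ) (S.indicator fun _ => (1 : ℂ))
  have h1 : ∀ᵐ x : V, 𝓕⁻ (fun ξ => charFun ρ (-(2 * π) • ξ)) x *
      S.indicator (fun _ => (1 : ℂ)) x = 0 := by
    filter_upwards [measure_eq_zero_iff_ae_notMem.1 h0] with x hx
    rw [Set.indicator_of_notMem hx, mul_zero]
  rw [integral_congr_ae h1, integral_zero, integral_indicator_const _ hS] at h
  simpa [Measure.real, ENNReal.toReal_eq_zero_iff] using h

/-- With the density of `ρ` in place, translation by `x` becomes a modulation on the Fourier side.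
The inverse transform is then moved onto `Φ`, and the substitution `a = -2πξ` produces the factor
`(2π)^(-d)`. -/
theorem integral_comp_add_eq_integral_fourierWeight {ρ : Measure V} [IsFiniteMeasure ρ]
    {Φ : V → ℝ} (hΦ : Integrable Φ) {C : ℝ} (hC : 0 < C)
    (hρ : ∀ ξ, ‖charFun ρ ξ‖ ≤ exp (-C * ‖ξ‖ ^ 2)) (x : V) :
    ((∫ v, Φ (x + v) ∂ρ : ℝ) : ℂ) =
      ∫ a, fourierWeight ρ Φ a * Complex.exp (⟪a, x⟫ * Complex.I) := by
  have hφ := integrable_charFun_neg_two_pi_smul hC hρ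
  rw [← integral_complex_ofReal, integral_eq_integral_mul_fourierInv_charFun ρ hφ]
  set g : V → ℂ := fun ξ => 𝐞 (-⟪ξ, x⟫) • charFun ρ (-(2 * π) • ξ) with hg
  have hgi : Integrable g := (Real.fourierIntegral_convergent_iff x).2 hφ
  have s1 : ∫ v, 𝓕⁻ (fun ξ => charFun ρ (-(2 * π) • ξ)) v * (Φ (x + v) : ℂ) =
      ∫ y, 𝓕⁻ g y * (Φ y : ℂ) := by
    rw [← integral_add_left_eq_self (fun y => 𝓕⁻ g y * (Φ y : ℂ)) x]
    refine integral_congr_ae (Filter.Eventually.of_forall fun v => ?_)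
    simp only
    congr 1
    rw [fourierInv_eq, fourierInv_eq]
    congr 1
    funext ξ
    rw [hg, smul_smul, ← AddChar.map_add_eq_mul, inner_add_right]
    congr 2
    ring
  have s2 := VectorFourier.integral_fourierIntegral_smul_eq_flip (μ := volume) (ν := volume)
    (L := -innerₗ V) (f := g) (g := fun y => (Φ y : ℂ)) continuous_fourierChar
    continuous_neg_innerₗ_apply hgi hΦ.ofReal
  rw [flip_neg_innerₗ] at s2
  have s3 : ∫ y, 𝓕⁻ g y * (Φ y : ℂ) = ∫ ξ, g ξ * 𝓕⁻ (fun y => (Φ y : ℂ)) ξ := s2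
  have s4 : ∀ ξ, g ξ * 𝓕⁻ (fun y => (Φ y : ℂ)) ξ =
      (fun a => charFun ρ a * 𝓕 (fun y => (Φ y : ℂ)) ((2 * π)⁻¹ • a) *
        Complex.exp (⟪a, x⟫ * Complex.I)) (-(2 * π) • ξ) := by
    intro ξ
    simp only [hg, fourierInv_eq_fourier_neg, smul_smul]
    rw [show (2 * π)⁻¹ * -(2 * π) = -1 by field_simp, neg_one_smul, Circle.smul_def,
      fourierChar_apply, inner_smul_left]
    simp only [smul_eq_mul, conj_trivial]
    have e : Complex.exp (((2 * π * -⟪ξ, x⟫ : ℝ) : ℂ) * Complex.I) =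
        Complex.exp (((-(2 * π) * ⟪ξ, x⟫ : ℝ) : ℂ) * Complex.I) := by
      congr 3; ring
    rw [e]
    ring
  rw [s1, s3]
  rw [integral_congr_ae (Filter.Eventually.of_forall s4)]
  rw [Measure.integral_comp_smul volume (fun a => charFun ρ a *
    𝓕 (fun y => (Φ y : ℂ)) ((2 * π)⁻¹ • a) * Complex.exp (⟪a, x⟫ * Complex.I))]
  have s5 : |((-(2 * π)) ^ Module.finrank ℝ V)⁻¹| = ((2 * π) ^ Module.finrank ℝ V)⁻¹ := by
    rw [abs_inv, abs_pow, abs_neg, abs_of_pos (by positivity)]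
  rw [s5, ← integral_smul]
  refine integral_congr_ae (Filter.Eventually.of_forall fun a => ?_)
  simp only [fourierWeight, Complex.real_smul]
  ring

end Fourier

/-! ### Bounds for the densities -/

section WeightBound

open Real

/-- Restrict the Gamma integral to `t > y`, where `t ^ s ≥ y ^ s`. -/
theorem rpow_mul_exp_neg_le_Gamma_add_one {s y : ℝ} (hs : 0 ≤ s) (hy : 0 ≤ y) :
    y ^ s * exp (-y) ≤ Gamma (s + 1) := by
  rw [Gamma_eq_integral (by linarith), add_sub_cancel_right]
  have hi := GammaIntegral_convergent (s := s + 1) (by linarith)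
  rw [add_sub_cancel_right] at hi
  calc y ^ s * exp (-y) = ∫ t in Set.Ioi y, exp (-t) * y ^ s := by
        rw [integral_mul_const, integral_exp_neg_Ioi, mul_comm]
    _ ≤ ∫ t in Set.Ioi y, exp (-t) * t ^ s := by
        refine setIntegral_mono_on ?_ (hi.mono_set (Set.Ioi_subset_Ioi hy)) measurableSet_Ioi ?_
        · exact (integrableOn_exp_neg_Ioi y).mul_const _
        · intro t ht
          have : y ≤ t := (Set.mem_Ioi.1 ht).le
          gcongr
    _ ≤ ∫ t in Set.Ioi 0, exp (-t) * t ^ s := by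
        refine setIntegral_mono_set hi ?_ (Set.Ioi_subset_Ioi hy).eventuallyLE
        filter_upwards [ae_restrict_mem measurableSet_Ioi] with t ht
        have : 0 < t := ht
        positivity

theorem multivariateTPDF_pos (d : ℕ) {ν : ℝ} (hν : 0 < ν) (x : EuclideanSpace ℝ (Fin d)) :
    0 < multivariateTPDF d ν x := by
  unfold multivariateTPDF
  have h1 := Gamma_pos_of_pos (show 0 < (ν + d) / 2 by positivity)
  have h2 := Gamma_pos_of_pos (show 0 < ν / 2 by positivity)
  positivity

theorem continuous_multivariateTPDF (d : ℕ) {ν : ℝ} (hν : 0 < ν) :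
    Continuous (multivariateTPDF d ν) := by
  unfold multivariateTPDF
  refine continuous_const.mul (Continuous.rpow_const (by fun_prop) fun x => Or.inl ?_)
  positivity

/-- The Gamma bound with `s = (ν + d) / 2` and `y = c (ν + ‖x‖²)`: `y ^ s` carries the tail of the
`t`-density, and `Γ(s + 1) = s Γ(s)` supplies both its normalization and the factor `(ν + d) / 2`.
-/
theorem exp_neg_mul_sq_le_multivariateTPDF_mul (d : ℕ) {ν c : ℝ} (hν : 0 < ν) (hc : 0 < c)
    (x : EuclideanSpace ℝ (Fin d)) :
    exp (-c * ‖x‖ ^ 2) ≤ multivariateTPDF d ν x *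
      ((ν + d) / 2 * (Gamma (ν / 2) * exp (c * ν) * (c * ν) ^ (-(ν / 2))) *
        (π / c) ^ ((d : ℝ) / 2)) := by
  set s := (ν + d) / 2 with hs
  have hs0 : 0 < s := by positivity
  set r := ‖x‖ ^ 2 with hr
  have hr0 : 0 ≤ r := by positivity
  have hb : 0 < 1 + ν⁻¹ * r := by positivity
  have h1 := Gamma_pos_of_pos hs0
  have h2 := Gamma_pos_of_pos (show 0 < ν / 2 by positivity)
  have key := rpow_mul_exp_neg_le_Gamma_add_one hs0.le
    (show 0 ≤ (c * ν) * (1 + ν⁻¹ * r) by positivity)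
  rw [Gamma_add_one hs0.ne', mul_rpow (by positivity) hb.le] at key
  have e1 : exp (-(c * ν * (1 + ν⁻¹ * r))) = (exp (c * ν))⁻¹ * exp (-c * r) := by
    rw [← exp_neg, ← exp_add]
    congr 1
    field_simp
    ring
  rw [e1] at key
  have e2 : (π / c) ^ ((d : ℝ) / 2) * (c * ν) ^ (-(ν / 2)) * (c * ν) ^ s =
      ν ^ ((d : ℝ) / 2) * π ^ ((d : ℝ) / 2) := by
    rw [mul_assoc, ← rpow_add (by positivity), hs,
      show -(ν / 2) + (ν + d) / 2 = (d : ℝ) / 2 by ring, ← mul_rpow (by positivity) (by positivity),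
      ← mul_rpow (by positivity) (by positivity)]
    congr 1
    field_simp
  have hX : 0 < (c * ν) ^ s := by positivity
  have hB : 0 < (1 + ν⁻¹ * r) ^ s := by positivity
  have hE : 0 < exp (c * ν) := exp_pos _
  have e3 : multivariateTPDF d ν x = Gamma s /
      (Gamma (ν / 2) * ((π / c) ^ ((d : ℝ) / 2) * (c * ν) ^ (-(ν / 2)) * (c * ν) ^ s)) *
        ((1 + ν⁻¹ * r) ^ s)⁻¹ := by
    rw [e2, multivariateTPDF, ← rpow_neg hb.le, ← mul_assoc, hs, neg_div]
  have hP : 0 < (π / c) ^ ((d : ℝ) / 2) := by positivity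
  have hQ : 0 < (c * ν) ^ (-(ν / 2)) := by positivity
  rw [e3]
  have e4 : Gamma s / (Gamma (ν / 2) * ((π / c) ^ ((d : ℝ) / 2) * (c * ν) ^ (-(ν / 2)) *
      (c * ν) ^ s)) * ((1 + ν⁻¹ * r) ^ s)⁻¹ *
      (s * (Gamma (ν / 2) * exp (c * ν) * (c * ν) ^ (-(ν / 2))) * (π / c) ^ ((d : ℝ) / 2)) =
      s * Gamma s * exp (c * ν) / ((c * ν) ^ s * (1 + ν⁻¹ * r) ^ s) := by
    field_simp
  rw [e4, le_div_iff₀ (by positivity)]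
  have := mul_le_mul_of_nonneg_right key hE.le
  refine Eq.trans_le ?_ this
  field_simp

theorem exists_exp_neg_mul_sq_le_multivariateTPDF {ν c : ℝ} (hν : 0 < ν) (hc : 1 < 4 * π * c) :
    ∃ K q : ℝ, 0 < K ∧ 0 < q ∧ q < 1 ∧ ∀ (d : ℕ) (x : EuclideanSpace ℝ (Fin d)),
      ((2 * π) ^ d)⁻¹ * exp (-c * ‖x‖ ^ 2) ≤ K * ((ν + d) * q ^ d) * multivariateTPDF d ν x := by
  have hc0 : 0 < c := by
    by_contra h
    nlinarith [pi_pos]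
  have h2 := Gamma_pos_of_pos (show 0 < ν / 2 by positivity)
  -- `q` arises from `(2π)^(-d) (π / c)^(d/2) = (4πc)^(-d/2)`.
  refine ⟨1 / 2 * (Gamma (ν / 2) * exp (c * ν) * (c * ν) ^ (-(ν / 2))), (4 * π * c) ^ (-(1 / 2) : ℝ),
    by positivity, by positivity, rpow_lt_one_of_one_lt_of_neg hc (by norm_num), fun d x => ?_⟩
  have h := exp_neg_mul_sq_le_multivariateTPDF_mul d hν hc0 x
  have e : ((2 * π) ^ d)⁻¹ * (π / c) ^ ((d : ℝ) / 2) = ((4 * π * c) ^ (-(1 / 2) : ℝ)) ^ d := by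
    have e1 : (2 * π) ^ d = ((2 * π) ^ 2) ^ ((d : ℝ) / 2) := by
      rw [← rpow_natCast _ 2, ← rpow_mul (by positivity), ← rpow_natCast]
      congr 1
      push_cast; ring
    rw [e1, ← rpow_natCast ((4 * π * c) ^ _), ← rpow_mul (by positivity),
      show -(1 / 2) * (d : ℝ) = -((d : ℝ) / 2) by ring, rpow_neg (by positivity),
      ← inv_rpow (by positivity), ← inv_rpow (by positivity),
      ← mul_rpow (by positivity) (by positivity)]
    congr 1
    field_simp
    ring
  rw [← e]
  refine (mul_le_mul_of_nonneg_left h (by positivity)).trans_eq ?_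
  ring

theorem Polynomial.exists_abs_eval_le (p : Polynomial ℝ) :
    ∃ c : ℝ, 0 ≤ c ∧ ∀ b : ℝ, |p.eval b| ≤ c * (1 + |b|) ^ p.natDegree := by
  refine ⟨∑ i ∈ Finset.range (p.natDegree + 1), |p.coeff i|,
    Finset.sum_nonneg fun _ _ => abs_nonneg _, fun b => ?_⟩
  rw [Polynomial.eval_eq_sum_range, Finset.sum_mul]
  refine (Finset.abs_sum_le_sum_abs _ _).trans (Finset.sum_le_sum fun i hi => ?_)
  rw [abs_mul, abs_pow]
  have hi' : i ≤ p.natDegree := by simpa [Nat.lt_succ_iff] using hi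
  have hb := abs_nonneg b
  gcongr
  calc |b| ^ i ≤ (1 + |b|) ^ i := by gcongr; linarith
    _ ≤ _ := pow_le_pow_right₀ (by linarith) hi'

theorem exists_one_add_pow_mul_exp_neg_sq_le (m : ℕ) {c : ℝ} (hc : 0 < c) :
    ∃ K : ℝ, 0 < K ∧ ∀ r : ℝ, 0 ≤ r → (1 + r) ^ m * exp (-c * r ^ 2) ≤ K := by
  refine ⟨m.factorial * exp (1 + 1 / (4 * c)), by positivity, fun r hr => ?_⟩
  have h1 := Real.pow_div_factorial_le_exp (1 + r) (by linarith) m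
  rw [div_le_iff₀ (by positivity)] at h1
  calc (1 + r) ^ m * exp (-c * r ^ 2) ≤ exp (1 + r) * m.factorial * exp (-c * r ^ 2) := by gcongr
    _ = m.factorial * exp (1 + r + -c * r ^ 2) := by rw [exp_add (1 + r)]; ring
    _ ≤ _ := by
      refine mul_le_mul_of_nonneg_left (exp_le_exp.2 ?_) (by positivity)
      have : r - c * r ^ 2 = 1 / (4 * c) - c * (r - 1 / (2 * c)) ^ 2 := by field_simp; ring
      nlinarith [mul_nonneg hc.le (sq_nonneg (r - 1 / (2 * c)))]

theorem exists_one_add_natCast_pow_mul_pow_le (m : ℕ) {q : ℝ} (hq : 0 < q) (hq1 : q < 1) :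
    ∃ K : ℝ, 0 < K ∧ ∀ d : ℕ, (1 + (d : ℝ)) ^ m * q ^ d ≤ K := by
  obtain ⟨K, hK⟩ := (tendsto_pow_const_mul_const_pow_of_lt_one m hq.le hq1).bddAbove_range
  refine ⟨(|K| + 1) / q, by positivity, fun d => ?_⟩
  rw [le_div_iff₀ hq]
  have := hK ⟨d + 1, rfl⟩
  simp only at this
  push_cast at this
  calc (1 + (d : ℝ)) ^ m * q ^ d * q = (d + 1) ^ m * q ^ (d + 1) := by ring
    _ ≤ K := this
    _ ≤ |K| + 1 := by linarith [le_abs_self K]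

/-- The Gaussian is split at the threshold `c`: the part with exponent `c` is compared with the
`t`-density and leaves `q ^ d`, which absorbs powers of `d`; the surplus `C - c` absorbs powers of
`‖a‖`. The restriction on `b` is the range outside which the ridge kernel with `R = d M ‖a‖`
vanishes. -/
theorem exists_weight_bound {ν C M : ℝ} (hν : 0 < ν) (hC : 1 / ((2 : ℝ) ^ (3 / 2 : ℝ) * π) < C)
    (hM : 0 < M) (p : Polynomial ℝ) :
    ∃ K : ℝ, 0 < K ∧ ∀ (d : ℕ) (a : EuclideanSpace ℝ (Fin d)) (b : ℝ),
      |b| ≤ d * M * ‖a‖ + 1 →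
      ((2 * π) ^ d)⁻¹ * exp (-C * ‖a‖ ^ 2) * |p.eval b| * (1 + ‖a‖ + |b|) ≤
        K * multivariateTPDF d ν a := by
  set c := 1 / ((2 : ℝ) ^ (3 / 2 : ℝ) * π) with hc
  have h2 : (2 : ℝ) ^ (3 / 2 : ℝ) < 4 := by
    have : (4 : ℝ) = 2 ^ (2 : ℝ) := by norm_num
    rw [this]
    exact rpow_lt_rpow_of_exponent_lt (by norm_num) (by norm_num)
  have h20 : 0 < (2 : ℝ) ^ (3 / 2 : ℝ) := by positivity
  -- Here `4πc = √2`.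
  have hc4 : 1 < 4 * π * c := by
    rw [hc]
    rw [mul_one_div, lt_div_iff₀ (by positivity)]
    nlinarith [pi_pos]
  obtain ⟨K1, q, hK1, hq, hq1, h1⟩ := exists_exp_neg_mul_sq_le_multivariateTPDF hν hc4
  obtain ⟨c0, hc0, hp⟩ := p.exists_abs_eval_le
  set n := p.natDegree
  obtain ⟨K2, hK2, hr⟩ := exists_one_add_pow_mul_exp_neg_sq_le (n + 1) (sub_pos.2 hC)
  -- Powers of `1 + d`: `n` from the polynomial, one from `1 + ‖a‖ + |b|`, one from `ν + d`.
  obtain ⟨K3, hK3, hd⟩ := exists_one_add_natCast_pow_mul_pow_le (n + 2) hq hq1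
  refine ⟨K1 * (ν + 1) * (c0 + 1) * (2 + M) ^ (n + 1) * K2 * K3, by positivity,
    fun d a b hb => ?_⟩
  set r := ‖a‖ with hrdef
  have hr0 : 0 ≤ r := norm_nonneg a
  have hT := multivariateTPDF_pos d hν a
  have hd0 : (0 : ℝ) ≤ d := Nat.cast_nonneg d
  have e1 : exp (-C * r ^ 2) = exp (-c * r ^ 2) * exp (-(C - c) * r ^ 2) := by
    rw [← exp_add]; congr 1; ring
  have hdr : 0 ≤ d * r := by positivity
  have hdm : 0 ≤ d * M := by positivity
  have hmr : 0 ≤ M * r := by positivity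
  have b0 := abs_nonneg b
  have b1 : 1 + |b| ≤ (2 + M) * (1 + d) * (1 + r) := by nlinarith
  have b2 : 1 + r + |b| ≤ (2 + M) * (1 + d) * (1 + r) := by nlinarith
  have b3 : |p.eval b| * (1 + r + |b|) ≤
      (c0 + 1) * ((2 + M) ^ (n + 1) * (1 + d) ^ (n + 1) * (1 + r) ^ (n + 1)) := by
    calc |p.eval b| * (1 + r + |b|)
        ≤ ((c0 + 1) * ((2 + M) * (1 + d) * (1 + r)) ^ n) * ((2 + M) * (1 + d) * (1 + r)) := by
          refine mul_le_mul ((hp b).trans ?_) b2 (by positivity) (by positivity)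
          gcongr
          linarith
      _ = _ := by rw [mul_pow, mul_pow]; ring
  have b4 : ν + d ≤ (ν + 1) * (1 + d) := by nlinarith
  calc ((2 * π) ^ d)⁻¹ * exp (-C * r ^ 2) * |p.eval b| * (1 + r + |b|)
      = (((2 * π) ^ d)⁻¹ * exp (-c * r ^ 2)) * exp (-(C - c) * r ^ 2) *
          (|p.eval b| * (1 + r + |b|)) := by rw [e1]; ring
    _ ≤ (K1 * (((ν + 1) * (1 + d)) * q ^ d) * multivariateTPDF d ν a) *
          exp (-(C - c) * r ^ 2) *
          ((c0 + 1) * ((2 + M) ^ (n + 1) * (1 + d) ^ (n + 1) * (1 + r) ^ (n + 1))) := by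
        refine mul_le_mul (mul_le_mul_of_nonneg_right ((h1 d a).trans ?_) (exp_pos _).le) b3
          (by positivity) (by positivity)
        gcongr
    _ = K1 * (ν + 1) * (c0 + 1) * (2 + M) ^ (n + 1) *
          ((1 + r) ^ (n + 1) * exp (-(C - c) * r ^ 2)) * ((1 + d) ^ (n + 2) * q ^ d) *
          multivariateTPDF d ν a := by ring
    _ ≤ _ := by
        gcongr
        · exact hr r hr0
        · exact hd d

end WeightBound

/-! ### The random network -/

/-- The output weight attached to hidden weights `(a, b)`. -/
noncomputable def outputWeight {d : ℕ} (ν M : ℝ) (πb : ℝ → ℝ)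
    (ρ : Measure (EuclideanSpace ℝ (Fin d))) (Φ : EuclideanSpace ℝ (Fin d) → ℝ)
    (z : EuclideanSpace ℝ (Fin d) × ℝ) : ℝ :=
  ridgeKernel (fourierWeight ρ Φ z.1) (d * M * ‖z.1‖) z.2 / (multivariateTPDF d ν z.1 * πb z.2)

theorem norm_le_of_mem_cube {d : ℕ} {M : ℝ} (hM : 0 ≤ M) {x : EuclideanSpace ℝ (Fin d)}
    (hx : x ∈ cube d M) : ‖x‖ ≤ d * M := by
  have h1 : ∀ j, ‖x j‖ ^ 2 ≤ M ^ 2 := fun j => by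
    rw [Real.norm_eq_abs]
    exact pow_le_pow_left₀ (abs_nonneg _) (abs_le.2 ⟨(hx j).1, (hx j).2⟩) 2
  rw [EuclideanSpace.norm_eq]
  refine Real.sqrt_le_iff.2 ⟨by positivity, ?_⟩
  refine (Finset.sum_le_card_nsmul _ _ (M ^ 2) fun j _ => h1 j).trans ?_
  rw [Finset.card_univ, Fintype.card_fin, nsmul_eq_mul, mul_pow]
  gcongr
  rcases Nat.eq_zero_or_pos d with h | h
  · simp [h]
  · have : (1 : ℝ) ≤ d := by exact_mod_cast h
    nlinarith

section Weight

variable {d : ℕ} {ν M C K : ℝ} {πb : ℝ → ℝ} {p : Polynomial ℝ}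
  {ρ : Measure (EuclideanSpace ℝ (Fin d))} {Φ : EuclideanSpace ℝ (Fin d) → ℝ}

theorem measurable_outputWeight [IsFiniteMeasure ρ] (hν : 0 < ν) (hb : Measurable πb)
    (hΦ : Integrable Φ) : Measurable (outputWeight ν M πb ρ Φ) := by
  unfold outputWeight
  refine (measurable_ridgeKernel ((measurable_fourierWeight hΦ).comp measurable_fst)
    (measurable_fst.norm.const_mul _) measurable_snd).div
    ((((continuous_multivariateTPDF d hν).measurable).comp measurable_fst).mul
      (hb.comp measurable_snd))

/-- The factor `1 + ‖z.1‖ + |z.2|` is kept because the same bound must control both the weight and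
the weight times the ReLU. -/
theorem abs_outputWeight_mul_le (hν : 0 < ν) (hM : 0 ≤ M)
    (hp : ∀ z, 0 < p.eval z) (hpb : ∀ z, 1 ≤ p.eval z * πb z)
    (hρ : ∀ ξ, ‖charFun ρ ξ‖ ≤ Real.exp (-C * ‖ξ‖ ^ 2)) (hK0 : 0 ≤ K)
    (hK : ∀ (a : EuclideanSpace ℝ (Fin d)) (b : ℝ), |b| ≤ d * M * ‖a‖ + 1 →
      ((2 * Real.pi) ^ d)⁻¹ * Real.exp (-C * ‖a‖ ^ 2) * |p.eval b| * (1 + ‖a‖ + |b|) ≤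
        K * multivariateTPDF d ν a)
    (z : EuclideanSpace ℝ (Fin d) × ℝ) :
    |outputWeight ν M πb ρ Φ z| * (1 + ‖z.1‖ + |z.2|) ≤ 28 * K * ∫ x, |Φ x| := by
  obtain ⟨a, b⟩ := z
  have hL : 0 ≤ ∫ x, |Φ x| := integral_nonneg fun x => abs_nonneg _
  have hT := multivariateTPDF_pos d hν a
  have hb : 0 < πb b := by
    by_contra h
    nlinarith [hp b, hpb b]
  simp only [outputWeight]
  by_cases h : |b| ≤ d * M * ‖a‖ + 1
  · have h1 : |ridgeKernel (fourierWeight ρ Φ a) (d * M * ‖a‖) b| ≤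
        28 * (((2 * Real.pi) ^ d)⁻¹ * (Real.exp (-C * ‖a‖ ^ 2) * ∫ x, |Φ x|)) := by
      refine (abs_ridgeKernel_le _ _ _).trans ?_
      have := norm_fourierWeight_le (Φ := Φ) hρ a
      rw [finrank_euclideanSpace_fin] at this
      gcongr
    rw [abs_div, abs_of_pos (mul_pos hT hb), div_mul_eq_mul_div, div_le_iff₀ (mul_pos hT hb)]
    have h2 := hK a b h
    rw [abs_of_pos (hp b)] at h2
    have h3 : ((2 * Real.pi) ^ d)⁻¹ * Real.exp (-C * ‖a‖ ^ 2) * (1 + ‖a‖ + |b|) ≤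
        K * multivariateTPDF d ν a * πb b := by
      calc ((2 * Real.pi) ^ d)⁻¹ * Real.exp (-C * ‖a‖ ^ 2) * (1 + ‖a‖ + |b|)
          = ((2 * Real.pi) ^ d)⁻¹ * Real.exp (-C * ‖a‖ ^ 2) * (1 + ‖a‖ + |b|) * 1 := by ring
        _ ≤ ((2 * Real.pi) ^ d)⁻¹ * Real.exp (-C * ‖a‖ ^ 2) * (1 + ‖a‖ + |b|) *
            (p.eval b * πb b) := by
          gcongr
          exact hpb b
        _ = ((2 * Real.pi) ^ d)⁻¹ * Real.exp (-C * ‖a‖ ^ 2) * p.eval b * (1 + ‖a‖ + |b|) *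
            πb b := by ring
        _ ≤ _ := by gcongr
    calc _ ≤ 28 * (((2 * Real.pi) ^ d)⁻¹ * (Real.exp (-C * ‖a‖ ^ 2) * ∫ x, |Φ x|)) *
          (1 + ‖a‖ + |b|) := by gcongr
      _ = 28 * (((2 * Real.pi) ^ d)⁻¹ * Real.exp (-C * ‖a‖ ^ 2) * (1 + ‖a‖ + |b|)) *
          ∫ x, |Φ x| := by ring
      _ ≤ 28 * (K * multivariateTPDF d ν a * πb b) * ∫ x, |Φ x| := by gcongr
      _ = _ := by ring
  · rw [ridgeKernel_eq_zero (by positivity) (not_le.1 h)]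
    simp only [zero_div, abs_zero, zero_mul]
    positivity

/-- Importance sampling: the densities cancel the denominator of the weight. The inner integral is
then the ridge formula and the outer one the real part of the Fourier representation. -/
theorem integral_outputWeight_mul_relu [IsFiniteMeasure ρ] (hν : 0 < ν) (hM : 0 ≤ M) (hC : 0 < C)
    (hbm : Measurable πb) (hb : ∀ z, 0 < πb z) (hΦ : Integrable Φ)
    (hρ : ∀ ξ, ‖charFun ρ ξ‖ ≤ Real.exp (-C * ‖ξ‖ ^ 2))
    [SFinite (multivariateT d ν)]
    [SFinite (volume.withDensity fun z => ENNReal.ofReal (πb z))]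
    {x : EuclideanSpace ℝ (Fin d)} (hx : x ∈ cube d M)
    (hi : Integrable (fun z : EuclideanSpace ℝ (Fin d) × ℝ =>
        outputWeight ν M πb ρ Φ z * relu (inner ℝ z.1 x + z.2))
      ((multivariateT d ν).prod (volume.withDensity fun z => ENNReal.ofReal (πb z)))) :
    ∫ z, outputWeight ν M πb ρ Φ z * relu (inner ℝ z.1 x + z.2)
        ∂((multivariateT d ν).prod (volume.withDensity fun z => ENNReal.ofReal (πb z))) =
      ∫ v, Φ (x + v) ∂ρ := by
  rw [integral_prod _ hi, multivariateT, integral_withDensity_eq_integral_toReal_smul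
    ((continuous_multivariateTPDF d hν).measurable.ennreal_ofReal)
    (Filter.Eventually.of_forall fun _ => ENNReal.ofReal_lt_top)]
  have e1 : ∀ a : EuclideanSpace ℝ (Fin d),
      (ENNReal.ofReal (multivariateTPDF d ν a)).toReal •
        ∫ b, outputWeight ν M πb ρ Φ (a, b) * relu (inner ℝ a x + b)
          ∂(volume.withDensity fun z => ENNReal.ofReal (πb z)) =
      (fourierWeight ρ Φ a * Complex.exp ((inner ℝ a x : ℝ) * Complex.I)).re := by
    intro a
    have hT := multivariateTPDF_pos d hν a
    rw [integral_withDensity_eq_integral_toReal_smul hbm.ennreal_ofReal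
      (Filter.Eventually.of_forall fun _ => ENNReal.ofReal_lt_top), ENNReal.toReal_ofReal hT.le,
      ← integral_smul]
    have hz : |inner ℝ a x| ≤ d * M * ‖a‖ := by
      refine (abs_real_inner_le_norm _ _).trans ?_
      rw [mul_comm]
      gcongr
      exact norm_le_of_mem_cube hM hx
    rw [← integral_ridgeKernel_mul_relu _ hz]
    refine integral_congr_ae (Filter.Eventually.of_forall fun b => ?_)
    simp only [outputWeight, ENNReal.toReal_ofReal (hb b).le, smul_eq_mul]
    have := (hb b).ne'
    have := hT.ne'
    field_simp
  rw [integral_congr_ae (Filter.Eventually.of_forall e1)]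
  have e2 := integral_comp_add_eq_integral_fourierWeight hΦ hC hρ x
  have e3 := integral_re (integrable_fourierWeight_mul_exp hΦ hC hρ x)
  simp only [RCLike.re_eq_complex_re] at e3
  rw [e3, ← e2, Complex.ofReal_re]

end Weight

/-! ### Joint law of the hidden weights and uniform Monte Carlo error -/

theorem map_pair_eq_pi_prod {Ω X : Type*} {N : ℕ} [MeasurableSpace Ω] [MeasurableSpace X]
    {P : Measure Ω} [IsProbabilityMeasure P] {A : Fin N → Ω → X} {B : Fin N → Ω → ℝ}
    (hA : ∀ i, Measurable (A i)) (hB : ∀ i, Measurable (B i)) {α : Measure X} {β : Measure ℝ}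
    [IsProbabilityMeasure α] [IsProbabilityMeasure β]
    (hAm : ∀ i, P.map (A i) = α) (hBm : ∀ i, P.map (B i) = β)
    (iA : iIndepFun A P) (iB : iIndepFun B P)
    (iAB : IndepFun (fun ω i => A i ω) (fun ω i => B i ω) P) :
    P.map (fun ω i => (A i ω, B i ω)) = Measure.pi fun _ => α.prod β := by
  have h1 := (iIndepFun_iff_map_fun_eq_pi_map fun i => (hA i).aemeasurable).1 iA
  have h2 := (iIndepFun_iff_map_fun_eq_pi_map fun i => (hB i).aemeasurable).1 iB
  have mA : Measurable fun ω i => A i ω := measurable_pi_lambda _ hA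
  have mB : Measurable fun ω i => B i ω := measurable_pi_lambda _ hB
  have h3 := (indepFun_iff_map_prod_eq_prod_map_map mA.aemeasurable mB.aemeasurable).1 iAB
  simp only [hAm] at h1
  simp only [hBm] at h2
  rw [h1, h2] at h3
  have mp := measurePreserving_arrowProdEquivProdArrow X ℝ (Fin N) (fun _ => α) (fun _ => β)
  rw [← mp.symm.map_eq, ← h3, Measure.map_map (MeasurableEquiv.measurable _) (mA.prodMk mB)]
  rfl

theorem iSup_ofReal_abs_le_of_denseRange {X ι : Type*} [TopologicalSpace X] {S : Set X}
    {g : X → ℝ} (hg : ContinuousOn g S) {e : ι → S} (he : DenseRange e)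
    (hb : BddAbove (Set.range fun i => |g (e i)|)) :
    ⨆ x ∈ S, ENNReal.ofReal |g x| ≤ ENNReal.ofReal (⨆ i, |g (e i)|) := by
  refine iSup₂_le fun x hx => ENNReal.ofReal_le_ofReal ?_
  have hc : Continuous fun y : S => |g y| := (continuousOn_iff_continuous_domRestrict.1 hg).abs
  exact he.induction_on (p := fun y : S => |g y| ≤ ⨆ i, |g (e i)|) ⟨x, hx⟩
    (isClosed_le hc continuous_const) fun i => le_ciSup hb i

/-- Uniform law of large numbers over the cube for ReLU ridge functions with a bounded weight. -/
theorem integral_ciSup_abs_sum_ridge_le {d N : ℕ} {M Q : ℝ} (hM : 0 ≤ M)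
    {μ : Measure (EuclideanSpace ℝ (Fin d) × ℝ)} [IsProbabilityMeasure μ]
    {w : EuclideanSpace ℝ (Fin d) × ℝ → ℝ} (hw : Measurable w)
    (hwQ : ∀ z, |w z| * (1 + ‖z.1‖ + |z.2|) ≤ Q) (e : ℕ → cube d M) :
    ∫ z : Fin N → EuclideanSpace ℝ (Fin d) × ℝ,
      ⨆ n, |∑ j, (w (z j) * relu (inner ℝ (z j).1 (e n : EuclideanSpace ℝ (Fin d)) + (z j).2) -
        ∫ z', w z' * relu (inner ℝ z'.1 (e n : EuclideanSpace ℝ (Fin d)) + z'.2) ∂μ)|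
      ∂(Measure.pi fun _ => μ) ≤ 4 * (d * M + 1) * Q * √N := by
  -- The comparison process `w(a, b) (a·x + b)` is the inner product of `w(a, b) (a, b)` with `(x,
  -- 1)`; the `L²` product norm supplies the Hilbert structure.
  let v : EuclideanSpace ℝ (Fin d) × ℝ → WithLp 2 (EuclideanSpace ℝ (Fin d) × ℝ) :=
    fun z => w z • WithLp.toLp 2 z
  let u : ℕ → WithLp 2 (EuclideanSpace ℝ (Fin d) × ℝ) := fun n => WithLp.toLp 2 ((e n : _), 1)
  have hnorm : ∀ z : EuclideanSpace ℝ (Fin d) × ℝ, ‖WithLp.toLp 2 z‖ ≤ ‖z.1‖ + |z.2| := by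
    intro z
    have h := WithLp.prod_norm_sq_eq_of_L2 (WithLp.toLp 2 z)
    refine abs_le_of_sq_le_sq' ?_ (by positivity) |>.2
    rw [h]
    simp only [WithLp.toLp_fst, WithLp.toLp_snd, Real.norm_eq_abs]
    nlinarith [mul_nonneg (norm_nonneg z.1) (abs_nonneg z.2)]
  have hin : ∀ z n, inner ℝ (v z) (u n) =
      w z * (inner ℝ z.1 (e n : EuclideanSpace ℝ (Fin d)) + z.2) := by
    intro z n
    simp only [v, u, inner_smul_left, WithLp.prod_inner_apply, conj_trivial]
    simp
  have hen : ∀ n, ‖(e n : EuclideanSpace ℝ (Fin d))‖ ≤ d * M := fun n =>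
    norm_le_of_mem_cube hM (e n).2
  have hu : ∀ n, ‖u n‖ ≤ d * M + 1 := fun n => (hnorm _).trans (by simpa using hen n)
  have hv : ∀ z, ‖v z‖ ≤ Q := by
    intro z
    simp only [v, norm_smul, Real.norm_eq_abs]
    refine (mul_le_mul_of_nonneg_left (hnorm z) (abs_nonneg _)).trans (le_trans ?_ (hwQ z))
    gcongr
    linarith
  have hQ : 0 ≤ Q := (norm_nonneg _).trans (hv 0)
  have hle : ∀ z n, |w z * relu (inner ℝ z.1 (e n : EuclideanSpace ℝ (Fin d)) + z.2)| ≤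
      |inner ℝ (v z) (u n)| := by
    intro z n
    rw [hin, abs_mul, abs_mul]
    exact mul_le_mul_of_nonneg_left (abs_relu_le _) (abs_nonneg _)
  have hzm : ∀ n, Measurable fun z : EuclideanSpace ℝ (Fin d) × ℝ =>
      inner ℝ z.1 (e n : EuclideanSpace ℝ (Fin d)) + z.2 := fun n =>
    (by fun_prop : Continuous fun z : EuclideanSpace ℝ (Fin d) × ℝ =>
      inner ℝ z.1 (e n : EuclideanSpace ℝ (Fin d)) + z.2).measurable
  refine integral_ciSup_abs_sum_centered_le (μ := μ) (v := v) (u := u) (D := Q * (d * M + 1))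
    (fun n => ?_) (fun z n => ?_) (fun n => ?_) hv hu (fun z i j => ?_) hle N
  · exact hw.mul (continuous_relu.measurable.comp (hzm n))
  · refine (hle z n).trans ((abs_real_inner_le_norm _ _).trans ?_)
    exact mul_le_mul (hv z) (hu n) (norm_nonneg _) hQ
  · simp only [hin]
    exact hw.mul (hzm n)
  · rw [hin, hin, ← mul_sub, ← mul_sub, abs_mul, abs_mul]
    exact mul_le_mul_of_nonneg_left (abs_relu_sub_relu_le _ _) (abs_nonneg _)

theorem abs_mul_relu_le {d : ℕ} {M Q : ℝ} (hM : 0 ≤ M)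
    {w : EuclideanSpace ℝ (Fin d) × ℝ → ℝ}
    (hwQ : ∀ z, |w z| * (1 + ‖z.1‖ + |z.2|) ≤ Q) (z : EuclideanSpace ℝ (Fin d) × ℝ)
    {x : EuclideanSpace ℝ (Fin d)} (hx : x ∈ cube d M) :
    |w z * relu (inner ℝ z.1 x + z.2)| ≤ (d * M + 1) * Q := by
  rw [abs_mul]
  have h1 : |relu (inner ℝ z.1 x + z.2)| ≤ (d * M + 1) * (1 + ‖z.1‖ + |z.2|) := by
    refine (abs_relu_le _).trans ((abs_add_le _ _).trans ?_)
    have h2 := abs_real_inner_le_norm z.1 x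
    have h3 : ‖z.1‖ * ‖x‖ ≤ ‖z.1‖ * (d * M) := by
      gcongr
      exact norm_le_of_mem_cube hM hx
    have h4 : 0 ≤ d * M := by positivity
    have h5 := norm_nonneg z.1
    have h6 := abs_nonneg z.2
    nlinarith [mul_nonneg h4 h6]
  calc |w z| * |relu (inner ℝ z.1 x + z.2)|
      ≤ |w z| * ((d * M + 1) * (1 + ‖z.1‖ + |z.2|)) := by gcongr
    _ = (d * M + 1) * (|w z| * (1 + ‖z.1‖ + |z.2|)) := by ring
    _ ≤ _ := by
      gcongr
      exact hwQ z

theorem integrable_mul_relu {d : ℕ} {M Q : ℝ} (hM : 0 ≤ M)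
    {μ : Measure (EuclideanSpace ℝ (Fin d) × ℝ)} [IsFiniteMeasure μ]
    {w : EuclideanSpace ℝ (Fin d) × ℝ → ℝ} (hw : Measurable w)
    (hwQ : ∀ z, |w z| * (1 + ‖z.1‖ + |z.2|) ≤ Q)
    {x : EuclideanSpace ℝ (Fin d)} (hx : x ∈ cube d M) :
    Integrable (fun z => w z * relu (inner ℝ z.1 x + z.2)) μ := by
  refine Integrable.of_bound (hw.mul (continuous_relu.measurable.comp ?_)).aestronglyMeasurable
    ((d * M + 1) * Q) (Filter.Eventually.of_forall fun z => abs_mul_relu_le hM hwQ z hx)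
  exact (by fun_prop : Continuous fun z : EuclideanSpace ℝ (Fin d) × ℝ =>
      inner ℝ z.1 x + z.2).measurable

theorem continuousOn_integral_mul_relu {d : ℕ} {M Q : ℝ} (hM : 0 ≤ M)
    {μ : Measure (EuclideanSpace ℝ (Fin d) × ℝ)} [IsFiniteMeasure μ]
    {w : EuclideanSpace ℝ (Fin d) × ℝ → ℝ} (hw : Measurable w)
    (hwQ : ∀ z, |w z| * (1 + ‖z.1‖ + |z.2|) ≤ Q) :
    ContinuousOn (fun x => ∫ z, w z * relu (inner ℝ z.1 x + z.2) ∂μ) (cube d M) := by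
  refine continuousOn_of_dominated (bound := fun _ => (d * M + 1) * Q)
    (fun x hx => (integrable_mul_relu hM hw hwQ hx).aestronglyMeasurable)
    (fun x hx => Filter.Eventually.of_forall fun z => abs_mul_relu_le hM hwQ z hx)
    (integrable_const _) (Filter.Eventually.of_forall fun z => ?_)
  exact (continuous_const.mul (continuous_relu.comp (by fun_prop))).continuousOn

/-- The expected uniform error over the cube of the Monte Carlo network. -/
theorem lintegral_iSup_abs_reluNetwork_sub_le {d N : ℕ} {M Q : ℝ} (hM : 0 ≤ M) (hN : 1 ≤ N)
    {μ : Measure (EuclideanSpace ℝ (Fin d) × ℝ)} [IsProbabilityMeasure μ]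
    {w : EuclideanSpace ℝ (Fin d) × ℝ → ℝ} (hw : Measurable w)
    (hwQ : ∀ z, |w z| * (1 + ‖z.1‖ + |z.2|) ≤ Q)
    {H : EuclideanSpace ℝ (Fin d) → ℝ}
    (hH : ∀ x ∈ cube d M, ∫ z, w z * relu (inner ℝ z.1 x + z.2) ∂μ = H x)
    {Ω : Type*} [MeasurableSpace Ω] {P : Measure Ω}
    {A : Fin N → Ω → EuclideanSpace ℝ (Fin d)} {B : Fin N → Ω → ℝ}
    (hA : ∀ i, Measurable (A i)) (hB : ∀ i, Measurable (B i))
    (hAB : P.map (fun ω i => (A i ω, B i ω)) = Measure.pi fun _ => μ) :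
    ∫⁻ ω, ⨆ x ∈ cube d M, ENNReal.ofReal |reluNetwork (fun i => A i ω) (fun i => B i ω)
        (fun i => w (A i ω, B i ω) / N) x - H x| ∂P
      ≤ ENNReal.ofReal (4 * (d * M + 1) * Q / √N) := by
  have hN0 : (0 : ℝ) < N := by exact_mod_cast hN
  have hne : Nonempty (cube d M) := ⟨⟨0, fun j => ⟨by simpa using hM, by simpa using hM⟩⟩⟩
  -- By continuity in `x` a countable dense set determines the supremum, which makes it measurable.
  let e : ℕ → cube d M := TopologicalSpace.denseSeq (cube d M)
  have he : DenseRange e := TopologicalSpace.denseRange_denseSeq _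
  have hQ : 0 ≤ Q := le_trans (by positivity) (hwQ 0)
  let m : EuclideanSpace ℝ (Fin d) → ℝ := fun x => ∫ z, w z * relu (inner ℝ z.1 x + z.2) ∂μ
  let G : (Fin N → EuclideanSpace ℝ (Fin d) × ℝ) → EuclideanSpace ℝ (Fin d) → ℝ := fun z x =>
    ∑ j, (w (z j) * relu (inner ℝ (z j).1 x + (z j).2) - m x)
  have hmb : ∀ x ∈ cube d M, |m x| ≤ (d * M + 1) * Q := fun x hx => by
    have := norm_integral_le_of_norm_le_const (μ := μ)
      (f := fun z => w z * relu (inner ℝ z.1 x + z.2))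
      (Filter.Eventually.of_forall fun z => abs_mul_relu_le hM hwQ z hx)
    simpa using this
  have hGb : ∀ z, ∀ x ∈ cube d M, |G z x| ≤ N * (2 * ((d * M + 1) * Q)) := by
    intro z x hx
    refine (Finset.abs_sum_le_sum_abs _ _).trans ?_
    refine (Finset.sum_le_card_nsmul _ _ (2 * ((d * M + 1) * Q)) fun j _ => ?_).trans (by simp)
    refine (abs_sub _ _).trans ?_
    linarith [abs_mul_relu_le hM hwQ (z j) hx, hmb x hx]
  have hGm : ∀ x, Measurable fun z => G z x := fun x =>
    Finset.measurable_sum _ fun j _ => (((hw.comp (measurable_pi_apply j)).mul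
      (continuous_relu.measurable.comp ((by fun_prop :
        Continuous fun z : EuclideanSpace ℝ (Fin d) × ℝ => inner ℝ z.1 x + z.2).measurable.comp
          (measurable_pi_apply j))))).sub_const _
  have hGc : ∀ z, ContinuousOn (fun x => G z x / N) (cube d M) := fun z =>
    (continuousOn_finsetSum _ fun j _ =>
      ((continuous_const.mul (continuous_relu.comp (by fun_prop))).continuousOn).sub
        (continuousOn_integral_mul_relu hM hw hwQ)).div_const _
  have hnet : ∀ ω, ∀ x ∈ cube d M, reluNetwork (fun i => A i ω) (fun i => B i ω)
      (fun i => w (A i ω, B i ω) / N) x - H x = G (fun i => (A i ω, B i ω)) x / N := by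
    intro ω x hx
    simp only [reluNetwork, G, Finset.sum_sub_distrib, Finset.sum_const, Finset.card_univ,
      Fintype.card_fin, nsmul_eq_mul, m, hH x hx]
    rw [sub_div, mul_div_cancel_left₀ _ hN0.ne', Finset.sum_div]
    congr 1
    refine Finset.sum_congr rfl fun i _ => ?_
    ring
  have hdiv : ∀ z x, |G z x / N| = |G z x| / N := fun z x => by
    rw [abs_div, abs_of_pos hN0]
  have hGi : Integrable (fun z => ⨆ n, |G z (e n)|)
      (Measure.pi fun _ : Fin N => μ) :=
    integrable_ciSup (fun n => (hGm _).norm) fun z n => by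
      rw [abs_abs]; exact hGb z _ (e n).2
  have hsm : Measurable fun z => ENNReal.ofReal ((⨆ n, |G z (e n)|) / N) :=
    ((Measurable.iSup fun n => (hGm _).norm).div_const _).ennreal_ofReal
  have mAB : Measurable fun ω i => (A i ω, B i ω) :=
    measurable_pi_lambda _ fun i => (hA i).prodMk (hB i)
  calc _ ≤ ∫⁻ ω, ENNReal.ofReal ((⨆ n, |G (fun i => (A i ω, B i ω)) (e n)|) / N) ∂P := by
        refine lintegral_mono fun ω => ?_
        have h1 : ⨆ x ∈ cube d M, ENNReal.ofReal |reluNetwork (fun i => A i ω) (fun i => B i ω)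
            (fun i => w (A i ω, B i ω) / N) x - H x| =
            ⨆ x ∈ cube d M, ENNReal.ofReal |G (fun i => (A i ω, B i ω)) x / N| :=
          iSup_congr fun x => iSup_congr fun hx => by rw [hnet ω x hx]
        rw [h1]
        refine (iSup_ofReal_abs_le_of_denseRange (hGc _) he ?_).trans_eq ?_
        · refine ⟨N * (2 * ((d * M + 1) * Q)) / N, ?_⟩
          rintro _ ⟨n, rfl⟩
          simp only [hdiv]
          gcongr
          exact hGb _ _ (e n).2
        · simp only [hdiv]
          simp only [div_eq_mul_inv, Real.iSup_mul_of_nonneg (inv_nonneg.2 hN0.le)]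
    _ = ∫⁻ z, ENNReal.ofReal ((⨆ n, |G z (e n)|) / N) ∂(Measure.pi fun _ : Fin N => μ) := by
        rw [← hAB, lintegral_map hsm mAB]
    _ = ENNReal.ofReal (∫ z, (⨆ n, |G z (e n)|) / N ∂(Measure.pi fun _ : Fin N => μ)) := by
        rw [ofReal_integral_eq_lintegral_ofReal (hGi.div_const _)]
        exact Filter.Eventually.of_forall fun z =>
          div_nonneg (Real.iSup_nonneg fun n => abs_nonneg _) hN0.le
    _ ≤ _ := by
        refine ENNReal.ofReal_le_ofReal ?_
        rw [integral_div]
        have h := integral_ciSup_abs_sum_ridge_le (N := N) (μ := μ) hM hw hwQ e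
        refine (div_le_div_of_nonneg_right h hN0.le).trans_eq ?_
        have hs : √(N : ℝ) * √(N : ℝ) = N := Real.mul_self_sqrt hN0.le
        have hs0 : 0 < √(N : ℝ) := Real.sqrt_pos.2 hN0
        rw [div_eq_div_iff hN0.ne' hs0.ne', mul_assoc, hs]

/-! ### Constants and assembly -/

theorem mainTheorem3
    (πb : ℝ → ℝ) (hπb_meas : Measurable πb) (hπb_decay : AtMostPolynomialDecay πb) :
    ∃ k : ℕ, 1 ≤ k ∧
      ∀ ν : ℝ, 1 < ν → ∀ C : ℝ, 1 / ((2 : ℝ) ^ (3 / 2 : ℝ) * Real.pi) < C → ∀ M : ℝ, 0 < M →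
      ∃ Capp : ℝ, 0 < Capp ∧ ∃ Cwgt : ℝ, 0 < Cwgt ∧
        ∀ d N : ℕ, 1 ≤ d → 1 ≤ N →
        -- the hidden weights
        ∀ (Ω : Type*) [MeasurableSpace Ω] (P : Measure Ω) [IsProbabilityMeasure P]
          (A : Fin N → Ω → EuclideanSpace ℝ (Fin d)) (B : Fin N → Ω → ℝ),
          (∀ i, Measurable (A i)) → (∀ i, Measurable (B i)) →
          (∀ i, P.map (A i) = multivariateT d ν) →
          (∀ i, P.map (B i) = volume.withDensity fun z => ENNReal.ofReal (πb z)) →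
          iIndepFun A P → iIndepFun B P →
          IndepFun (fun ω i => A i ω) (fun ω i => B i ω) P →
        -- the target function
        ∀ (Ω' : Type*) [MeasurableSpace Ω'] (P' : Measure Ω') [IsProbabilityMeasure P']
          (V : Ω' → EuclideanSpace ℝ (Fin d)) (Φ H : EuclideanSpace ℝ (Fin d) → ℝ),
          Measurable V →
          (∀ ξ, ‖charFun (P'.map V) ξ‖ ≤ Real.exp (-C * ‖ξ‖ ^ 2)) →
          Integrable Φ volume →
          (∀ x, H x = ∫ ω', Φ (x + V ω') ∂P') →
        ∃ W : Ω → Fin N → ℝ,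
          Measurable[hiddenSigma A B] W ∧
          ∫⁻ ω, ⨆ x ∈ cube d M,
              ENNReal.ofReal |reluNetwork (fun i => A i ω) (fun i => B i ω) (W ω) x - H x| ∂P
            ≤ ENNReal.ofReal
                (Capp * (∫ x, |Φ x|) * (ν + d) ^ (k + 3) / Real.sqrt N) ∧
          ∀ i, eLpNorm (fun ω => W ω i) ∞ P
            ≤ ENNReal.ofReal
                (Cwgt * (∫ x, |Φ x|) * (ν + d) ^ (2 * (k : ℝ) + 1 / 2) / N) := by
  obtain ⟨p, hp, hpb⟩ := hπb_decay
  refine ⟨1, le_rfl, fun ν hν C hC M hM => ?_⟩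
  have hν0 : 0 < ν := by linarith
  have hC0 : 0 < C := lt_trans (by positivity) hC
  obtain ⟨K, hK0, hK⟩ := exists_weight_bound hν0 hC hM p
  -- `4` comes from the empirical process bound, `M + 1` from `d M + 1 ≤ (M + 1) (ν + d)`, and `28`
  -- from the sup bound on the ridge kernel.
  refine ⟨4 * (M + 1) * (28 * K), by positivity, 28 * K, by positivity, ?_⟩
  intro d N hd hN Ω _ P _ A B hA hB hAm hBm iA iB iAB Ω' _ P' _ V Φ H hV hchar hΦ hH
  have hb : ∀ z, 0 < πb z := fun z => by
    by_contra h
    nlinarith [hp z, hpb z]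
  have hL : 0 ≤ ∫ x, |Φ x| := integral_nonneg fun x => abs_nonneg _
  have : IsProbabilityMeasure (multivariateT d ν) := by
    rw [← hAm ⟨0, hN⟩]
    exact Measure.isProbabilityMeasure_map (hA _).aemeasurable
  have : IsProbabilityMeasure (volume.withDensity fun z => ENNReal.ofReal (πb z)) := by
    rw [← hBm ⟨0, hN⟩]
    exact Measure.isProbabilityMeasure_map (hB _).aemeasurable
  have : IsProbabilityMeasure (P'.map V) := Measure.isProbabilityMeasure_map hV.aemeasurable
  set w := outputWeight ν M πb (P'.map V) Φ
  have hwm : Measurable w := measurable_outputWeight hν0 hπb_meas hΦ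
  have hwQ : ∀ z, |w z| * (1 + ‖z.1‖ + |z.2|) ≤ 28 * K * ∫ x, |Φ x| :=
    abs_outputWeight_mul_le hν0 hM.le hp hpb hchar hK0.le (hK d)
  have hrep : ∀ x ∈ cube d M, ∫ z, w z * relu (inner ℝ z.1 x + z.2)
      ∂((multivariateT d ν).prod (volume.withDensity fun z => ENNReal.ofReal (πb z))) = H x := by
    intro x hx
    rw [integral_outputWeight_mul_relu hν0 hM.le hC0 hπb_meas hb hΦ hchar hx
      (integrable_mul_relu hM.le hwm hwQ hx), hH]
    exact integral_map hV.aemeasurable ((hΦ.comp_add_left x).aestronglyMeasurable.mono_ac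
      (absolutelyContinuous_of_norm_charFun_le hC0 hchar))
  clear_value w
  have hd1 : (1 : ℝ) ≤ d := by exact_mod_cast hd
  have hN0 : (0 : ℝ) < N := by exact_mod_cast hN
  have hνd : 1 ≤ ν + d := by linarith
  refine ⟨fun ω i => w (A i ω, B i ω) / N, ?_, ?_, fun i => ?_⟩
  · have hg : Measurable fun q : (Fin N → EuclideanSpace ℝ (Fin d)) × (Fin N → ℝ) =>
        fun i => w (q.1 i, q.2 i) / N :=
      measurable_pi_lambda _ fun i => (hwm.comp (((measurable_pi_apply i).comp
        measurable_fst).prodMk ((measurable_pi_apply i).comp measurable_snd))).div_const _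
    have hc : Measurable[hiddenSigma A B] fun ω => ((fun i => A i ω), (fun i => B i ω)) :=
      comap_measurable _
    exact @Measurable.comp _ _ _ (hiddenSigma A B) _ _ _ _ hg hc
  · refine (lintegral_iSup_abs_reluNetwork_sub_le hM.le hN hwm hwQ hrep hA hB
      (map_pair_eq_pi_prod hA hB hAm hBm iA iB iAB)).trans (ENNReal.ofReal_le_ofReal ?_)
    -- The error grows only linearly in `ν + d`; the remaining powers are slack.
    have h1 : d * M + 1 ≤ (M + 1) * (ν + d) ^ (1 + 3) := by
      have h2 : (ν + d) ≤ (ν + d) ^ (1 + 3) := le_self_pow₀ hνd (by norm_num)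
      have h3 : d * M + 1 ≤ (M + 1) * (ν + d) := by nlinarith
      exact h3.trans (by gcongr)
    refine div_le_div_of_nonneg_right ?_ (Real.sqrt_nonneg _)
    calc 4 * (d * M + 1) * (28 * K * ∫ x, |Φ x|)
        ≤ 4 * ((M + 1) * (ν + d) ^ (1 + 3)) * (28 * K * ∫ x, |Φ x|) := by gcongr
      _ = _ := by ring
  · rw [eLpNorm_exponent_top]
    refine eLpNormEssSup_le_of_ae_bound (Filter.Eventually.of_forall fun ω => ?_)
    rw [norm_div, Real.norm_eq_abs, Real.norm_of_nonneg hN0.le]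
    refine div_le_div_of_nonneg_right ?_ hN0.le
    have h1 := hwQ (A i ω, B i ω)
    have h2 : |w (A i ω, B i ω)| ≤ 28 * K * ∫ x, |Φ x| := by
      refine le_trans ?_ h1
      refine le_mul_of_one_le_right (abs_nonneg _) ?_
      have := norm_nonneg (A i ω)
      have := abs_nonneg (B i ω)
      simp only
      linarith
    -- The weight bound is already free of the dimension, so the power of `ν + d` only has to be at
    -- least 1.
    refine h2.trans (le_mul_of_one_le_right (by positivity) ?_)
    exact Real.one_le_rpow hνd (by norm_num)
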